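/- **Setting.** Let $\theta\in(-\frac\pi2,\frac\pi2)$ and $0<\delta<\pi\cos\theta$, write $\theta_\gamma=\operatorname{Arg}\gamma\in(-\pi,\pi]$, and put $$W_\theta=\{w\in\mathbb C : |\Re(e^{i\theta}w)|<\pi\cos\theta-\delta\},\qquad U_\theta=\{\gamma\in\mathbb C\setminus\{0\} : \cos(\theta+\theta_\gamma)>0\}.$$ For $\Re\gamma>0$, $|\Re w|<\pi+\Re\gamma$ let $$g_\gamma(w)=\int_{\mathbb R+i\epsilon}\frac{e^{wz}}{\sinh(\pi z)\,z}\,\frac{dz}{\sinh(\gamma z)}$$ with $\epsilon>0$ small. More generally let $g_\gamma(w)$ be the same integral along a line $e^{i\varphi}(\mathbb R+i\epsilon)$, where $|\varphi|<\frac\pi2$, $\Re(e^{i\varphi}\gamma)>0$, $|\Re(e^{i\varphi}w)|<\Re(e^{i\varphi}(\pi+\gamma))$, and $0<\epsilon<\min\big(\cos\varphi,\ \pi\,\Re(e^{i\varphi}\gamma)/|\gamma|^2\big)$. Faddeev's quantum dilogarithm is $S_\gamma(w)=\exp(\frac14 g_\gamma(w))$, and $\operatorname{Log}S_\gamma(w):=\frac14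 g_\gamma(w)$. With $B_{2m}$ the Bernoulli numbers, let $$P^{2n}_\gamma(w)=\frac1{2i}\sum_{m=0}^n\frac{2(1-2^{2m-1})B_{2m}}{(2m)!}\,\gamma^{2m-1}\Big(\frac{\partial}{\partial w}\Big)^{2m}\mathrm{Li}_2(-e^{iw}),$$ where $\mathrm{Li}_2(-e^{iw})$ denotes the analytic continuation of $\sum_{k\ge1}(-e^{iw})^k/k^2$ from $\Im w>0$ to $\mathbb C\setminus\{x\in\mathbb R:|x|\ge\pi\}\supset W_\theta$; for $\Im w<0$ it equals $\frac{w^2}2-\frac{\pi^2}6-\sum_{k\ge1}(-e^{-iw})^k/k^2$. Finally let $$c^F=\frac{\sqrt2}{\sqrt\pi\,(1-e^{-2})},\qquad c'_{N}=\inf_{r\in(0,\pi)}\frac1{r^{N}}\Big(\frac{c^F}{r}+\frac1{\sin r}\Big).$$ **Theorem.** For all $\theta\in(-\frac\pi2,\frac\pi2)$ and $0<\delta<\pi\cos\theta$ the function $w\mapsto\mathrm{Li}_2(-e^{iw})$ is holomorphic on $W_\theta$. For all $(w,\gamma)\in W_\theta\times U_\theta$ the integral $g_\gamma(w)$ may be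 taken with $\varphi=\theta$ and all small $\epsilon>0$, and it converges absolutely and has the same value for all $(\varphi,\epsilon)$ allowed above. For all positive integers $n$, $$\big|\operatorname{Log}S_\gamma(w)-P^{2n}_\gamma(w)\big|\le \tilde C^F_{2n}\,|\gamma|^{2n}\,\delta^{-2n}\,(2n)!,$$ where $$\begin{aligned}\tilde C^F_{2n}&=\frac{4\sqrt2}{\pi\sqrt{4n-3}}\,\frac1{(1-\frac1{2n})^{2n-1}}\,\frac{c'_{2n}}{(1-e^{-2\pi\cos\theta})\cos(\theta+\theta_\gamma)}\\ &\le\frac{4\sqrt2}{\pi\sqrt{4n-3}}\,\frac{\sqrt2+\frac{4c^F}{3\pi}}{(1-\frac1{2n})^{2n-1}}\Big(\frac23\Big)^{2n}\frac1{(1-e^{-2\pi\cos\theta})\cos(\theta+\theta_\gamma)}\Big(\frac2\pi\Big)^{2n}\\ &\le\frac{3}{(1-e^{-2\pi\cos\theta})\cos(\theta+\theta_\gamma)}\Big(\frac2\pi\Big)^{2n}.\end{aligned}$$ -/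

import Mathlib

noncomputable section

/-- The function `z ↦ K_F(w, z) * f_F(γ z)`, with `K_F(w, z) = exp(w z) / (sinh(π z) z)` and
`f_F(z) = 1 / sinh z`. -/
def faddeevIntegrand (γ w z : ℂ) : ℂ :=
  Complex.exp (w * z) / (Complex.sinh (Real.pi * z) * z) * (1 / Complex.sinh (γ * z))

/-- The parametrisation `t ↦ exp(i φ) (t + i ε)` of the rotated line `exp(i φ) (ℝ + i ε)`. -/
def rotatedLine (φ ε t : ℝ) : ℂ :=
  Complex.exp (φ * Complex.I) * (t + ε * Complex.I)

/-- The integral of `faddeevIntegrand γ w` along the line `exp(i φ) (ℝ + i ε)`. -/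
def faddeevContourIntegral (φ ε : ℝ) (γ w : ℂ) : ℂ :=
  ∫ t : ℝ, faddeevIntegrand γ w (rotatedLine φ ε t) * Complex.exp (φ * Complex.I)

/-- The contours that may be used for the pair `(γ, w)`: the angle `φ` lies in `(-π/2, π/2)`, the
poles `i k` and `i π k / γ` of the integrand lie above the contour for `k ≥ 1` and below it for
`k ≤ 0`, and the integrand decays exponentially at both ends.
For `φ = 0` the conditions read `0 < Re γ`, `|Re w| < π + Re γ`, and `ε > 0` is small. -/
structure FaddeevAdmissible (γ w : ℂ) (φ ε : ℝ) : Prop where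
  angle_gt : -(Real.pi / 2) < φ
  angle_lt : φ < Real.pi / 2
  re_pos : 0 < (γ * Complex.exp (φ * Complex.I)).re
  decay : |(w * Complex.exp (φ * Complex.I)).re| <
    ((Real.pi + γ) * Complex.exp (φ * Complex.I)).re
  eps_pos : 0 < ε
  eps_lt : ε < Real.cos φ
  eps_lt' : ε * ‖γ‖ ^ 2 < Real.pi * (γ * Complex.exp (φ * Complex.I)).re

open Classical in
/-- The function `g^F_γ(w)`: the integral of `faddeevIntegrand γ w` along an admissible contour
(`0` if there is none). The theorem asserts that the choice of the contour is irrelevant. -/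
def faddeevG (γ w : ℂ) : ℂ :=
  if h : ∃ p : ℝ × ℝ, FaddeevAdmissible γ w p.1 p.2 then
    faddeevContourIntegral h.choose.1 h.choose.2 γ w
  else 0

/-- Faddeev's quantum dilogarithm `S_γ(w) = exp(g^F_γ(w) / 4)`. -/
def faddeevS (γ w : ℂ) : ℂ := Complex.exp (1 / 4 * faddeevG γ w)

/-- The branch `g^F_γ(w) / 4` of the logarithm of `S_γ(w)`. -/
def faddeevLogS (γ w : ℂ) : ℂ := 1 / 4 * faddeevG γ w

/-- The dilogarithm series `Li₂(z) = ∑_{k ≥ 1} z ^ k / k ^ 2`, used for `|z| ≤ 1`. -/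
def liTwo (z : ℂ) : ℂ := ∑' k : ℕ, z ^ (k + 1) / ((k : ℂ) + 1) ^ 2

/-- The function `w ↦ Li₂(-exp(i w))` on `ℂ ∖ {x ∈ ℝ : |x| ≥ π}`: the series where
`|exp(i w)| ≤ 1`, and its analytic continuation through the interval `(-π, π)`, which is given by
the inversion formula `Li₂(-exp(i w)) + Li₂(-exp(-i w)) = w ^ 2 / 2 - π ^ 2 / 6`, elsewhere. -/
def liTwoNegExp (w : ℂ) : ℂ :=
  if 0 ≤ w.im then liTwo (-Complex.exp (Complex.I * w))
  else w ^ 2 / 2 - (Real.pi : ℂ) ^ 2 / 6 - liTwo (-Complex.exp (-(Complex.I * w)))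

/-- The Laurent polynomial `P^{2n}_γ(w)` in `γ`. -/
def faddeevP (n : ℕ) (γ w : ℂ) : ℂ :=
  1 / (2 * Complex.I) * ∑ m ∈ Finset.range (n + 1),
    2 * (1 - (2 : ℂ) ^ (2 * (m : ℤ) - 1)) * ((bernoulli (2 * m) : ℚ) : ℂ) /
      ((2 * m).factorial : ℂ) * γ ^ (2 * (m : ℤ) - 1) * iteratedDeriv (2 * m) liTwoNegExp w

/-- The strip `W^F_θ`; its defining quantity is `Re (w exp(i θ))`. -/
def faddeevW (θ δ : ℝ) : Set ℂ :=
  {w | -(Real.pi * Real.cos θ) + δ < w.re * Real.cos θ - w.im * Real.sin θ ∧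
    w.re * Real.cos θ - w.im * Real.sin θ < Real.pi * Real.cos θ - δ}

/-- The sector `U^F_θ`, that is, `Re (γ exp(i θ)) > 0`. -/
def faddeevU (θ : ℝ) : Set ℂ :=
  {γ | γ ≠ 0 ∧ 0 < Real.cos (θ + Complex.arg γ)}

/-- The constant `c^F`. -/
def faddeevCF : ℝ := √2 / (√Real.pi * (1 - Real.exp (-2)))

/-- The constant `c'_N`, the infimum over `r ∈ (0, π)` of `r⁻ᴺ (c^F / r + 1 / sin r)`. -/
def faddeevC' (N : ℕ) : ℝ :=
  ⨅ r : Set.Ioo (0 : ℝ) Real.pi,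
    1 / (r : ℝ) ^ N * (faddeevCF / (r : ℝ) + 1 / Real.sin (r : ℝ))

/-- The constant of the estimate for `P^{2n}_γ`. -/
def faddeevConst (n : ℕ) (θ : ℝ) (γ : ℂ) : ℝ :=
  4 * √2 / (Real.pi * √(4 * (n : ℝ) - 3)) * (1 / (1 - 1 / (2 * (n : ℝ))) ^ (2 * n - 1)) *
    (faddeevC' (2 * n) /
      ((1 - Real.exp (-(2 * Real.pi * Real.cos θ))) * Real.cos (θ + Complex.arg γ)))

end

/-!
Write `z = e^{iθ}(t + iε)` for a point of the line of integration. The proof expands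
`1 / sinh (γ z)` and integrates the expansion against `e^{wz} / (z sinh (π z))`.

*Independence of the contour.* Admissible pairs `(φ, ε)` can be joined by lowering `ε` and then
rotating, because for fixed `ε` the admissible angles form an interval
(`FaddeevAdmissible.of_mem_Icc`). Parallel shifts are Cauchy's theorem on a rectangle
(`integral_rotatedLine_shift`), rotations are Green's theorem in the coordinates `(φ, t)`
(`integral_rotatedLine_rotate`); both need only the exponential decay of the integrand.

*The terms of the expansion.* The integrals `J_j(w) = dilogMoment θ ε j w` of
`e^{wz} z^j / sinh (π z)` satisfy `d/dw J_j = J_{j+1}`. As `sinh (π z)` changes sign under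
`z ↦ z + i`, the integral `J_0` satisfies a linear equation in terms of `J_0(0) = -i`, whose
solution is `-2i e^{iw} / (1 + e^{iw})`. Integrating twice, with constants
fixed by the decay of `J_j` as `Im w → ∞`, gives `J_{-2} = -2i Li₂(-e^{iw})` in the upper half of the
strip. The reflection formula for `J_{-2}(w) + J_{-2}(-w)` then matches the inversion formula of the
dilogarithm, so the identity holds on the whole strip (`dilogMoment_neg_two`). In particular the
continued dilogarithm is holomorphic there, and its derivative of order `2m` is a multiple of
`J_{2m-2}`. Hence `P_γ^{2n}` is exactly the contribution of the Laurent polynomial of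
`1 / sinh (γ z)`.

*The remainder.* From the partial fractions
`1 / sinh u = 1 / u + ∑_{k ≥ 1} (-1)^k 2u / (u² + π² k²)` the remainder of the Laurent expansion is
again a series of partial fractions (`hasSum_cschRem`), and `|u² + a²| ≥ 2a |Re u|` bounds it by a
multiple of `|u|^{2n} / cos (arg u)` (`norm_cschRem_le`). It vanishes at the origin to order
`2n + 1`, so that the line can be moved to pass through the origin, where the bound integrates to a
sum of two Gamma integrals. The infimum `c'_{2n}` is bounded below by `π^{-2n}`, which leaves enough
room to absorb all constants, and above by the value at `r = 3π/4`.
-/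

section

open Complex Set Filter Topology MeasureTheory

/-! ### Moving the line of integration -/

lemma rotatedLine_mul_exp_neg (φ ε t : ℝ) :
    rotatedLine φ ε t * exp (-(φ * I)) = t + ε * I := by
  rw [rotatedLine, mul_right_comm, ← exp_add]; simp

lemma continuous_rotatedLine : Continuous fun p : (ℝ × ℝ) × ℝ => rotatedLine p.1.1 p.1.2 p.2 := by
  unfold rotatedLine; fun_prop

lemma norm_rotatedLine (φ ε t : ℝ) : ‖rotatedLine φ ε t‖ = ‖(t + ε * I : ℂ)‖ := by
  rw [rotatedLine, norm_mul, norm_exp_ofReal_mul_I, one_mul]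

lemma norm_rotatedLine_le (φ ε t : ℝ) : ‖rotatedLine φ ε t‖ ≤ |t| + |ε| := by
  rw [norm_rotatedLine]
  refine (norm_add_le _ _).trans (by simp)

lemma abs_le_norm_rotatedLine (φ ε t : ℝ) : |t| ≤ ‖rotatedLine φ ε t‖ := by
  rw [norm_rotatedLine]
  simpa using abs_re_le_norm (t + ε * I : ℂ)

lemma abs_le_norm_rotatedLine' (φ ε t : ℝ) : |ε| ≤ ‖rotatedLine φ ε t‖ := by
  rw [norm_rotatedLine]
  simpa using abs_im_le_norm (t + ε * I : ℂ)

lemma tendsto_exp_neg_mul_atTop {κ : ℝ} (hκ : 0 < κ) (A B : ℝ) :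
    Tendsto (fun T : ℝ => A * Real.exp (-κ * T) * (T + B)) atTop (𝓝 0) := by
  have h1 : Tendsto (fun T : ℝ => T * Real.exp (-κ * T)) atTop (𝓝 0) := by
    simpa using tendsto_rpow_mul_exp_neg_mul_atTop_nhds_zero 1 κ hκ
  have h2 : Tendsto (fun T : ℝ => Real.exp (-κ * T)) atTop (𝓝 0) := by
    simpa using tendsto_rpow_mul_exp_neg_mul_atTop_nhds_zero 0 κ hκ
  have := (h1.const_mul A).add (h2.const_mul (A * B))
  simp only [mul_zero, add_zero] at this
  exact this.congr fun T => by ring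

/-- A continuous function on the line with exponential decay at both ends is integrable. -/
lemma integrable_of_exp_bound {h : ℝ → ℂ} {C κ T₀ : ℝ} (hκ : 0 < κ) (hc : Continuous h)
    (hb : ∀ t, T₀ ≤ |t| → ‖h t‖ ≤ C * Real.exp (-κ * |t|)) : Integrable h := by
  refine hc.locallyIntegrable.integrable_of_isBigO_atBot_atTop
    (g := fun t => Real.exp (κ * t)) (g' := fun t => Real.exp (-κ * t)) ?_ ?_ ?_ ?_
  · refine Asymptotics.IsBigO.of_bound C ?_
    filter_upwards [eventually_le_atBot 0, eventually_le_atBot (-T₀)] with t ht ht'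
    have := hb t (by rw [abs_of_nonpos ht]; linarith)
    rw [abs_of_nonpos ht] at this
    simpa using this
  · exact ⟨Iic 0, Iic_mem_atBot 0, integrableOn_exp_mul_Iic hκ 0⟩
  · refine Asymptotics.IsBigO.of_bound C ?_
    filter_upwards [eventually_ge_atTop 0, eventually_ge_atTop T₀] with t ht ht'
    have := hb t (by rw [abs_of_nonneg ht]; linarith)
    rw [abs_of_nonneg ht] at this
    simpa using this
  · exact ⟨Ioi 0, Ioi_mem_atTop 0, exp_neg_integrableOn_Ioi 0 hκ⟩

/-- If the integrals of `h₀` and `h₁` over `[-T, T]` agree up to `C exp (-κ T) (T + B)`, then the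
integrals over the whole line agree. -/
lemma integral_eq_of_interval_bound {h₀ h₁ : ℝ → ℂ} {C κ B T₀ : ℝ} (hκ : 0 < κ)
    (h0 : Integrable h₀) (h1 : Integrable h₁)
    (hT : ∀ T, T₀ ≤ T →
      ‖(∫ t in (-T)..T, h₀ t) - ∫ t in (-T)..T, h₁ t‖ ≤ C * Real.exp (-κ * T) * (T + B)) :
    ∫ t, h₀ t = ∫ t, h₁ t := by
  have l0 := intervalIntegral_tendsto_integral h0 tendsto_neg_atTop_atBot tendsto_id
  have l1 := intervalIntegral_tendsto_integral h1 tendsto_neg_atTop_atBot tendsto_id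
  have l2 : Tendsto (fun T : ℝ => (∫ t in (-T)..T, h₀ t) - ∫ t in (-T)..T, h₁ t) atTop (𝓝 0) := by
    refine squeeze_zero_norm' ?_ (tendsto_exp_neg_mul_atTop hκ C B)
    filter_upwards [eventually_ge_atTop T₀] with T h using hT T h
  exact sub_eq_zero.1 (tendsto_nhds_unique (l0.sub l1) l2)

/-- Cauchy's theorem for a strip: the integral over a line does not change when the line is moved
parallel to itself, if the integrand decays exponentially in the strip that is swept out. -/
theorem integral_rotatedLine_shift {f : ℂ → ℂ} {θ a b C κ T₀ : ℝ} {s : Set ℂ} (hab : a ≤ b)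
    (hκ : 0 < κ) (hs : s.Countable)
    (hc : ∀ ε ∈ Icc a b, ∀ t, ContinuousAt f (rotatedLine θ ε t))
    (hd : ∀ ε ∈ Icc a b, ∀ t, rotatedLine θ ε t ∉ s → DifferentiableAt ℂ f (rotatedLine θ ε t))
    (hb : ∀ ε ∈ Icc a b, ∀ t, T₀ ≤ |t| → ‖f (rotatedLine θ ε t)‖ ≤ C * Real.exp (-κ * |t|)) :
    ∫ t, f (rotatedLine θ a t) = ∫ t, f (rotatedLine θ b t) := by
  have hcl : ∀ ε ∈ Icc a b, Continuous fun t => f (rotatedLine θ ε t) := fun ε hε =>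
    continuous_iff_continuousAt.2 fun t => (hc ε hε t).comp
      (continuous_rotatedLine.comp (by fun_prop : Continuous fun t : ℝ => ((θ, ε), t))).continuousAt
  have ha : a ∈ Icc a b := left_mem_Icc.2 hab
  have hb' : b ∈ Icc a b := right_mem_Icc.2 hab
  refine integral_eq_of_interval_bound (T₀ := max T₀ 0) (C := 2 * C * (b - a)) (B := 1) hκ
    (integrable_of_exp_bound hκ (hcl a ha) (hb a ha))
    (integrable_of_exp_bound hκ (hcl b hb') (hb b hb')) fun T hT => ?_
  have hT0 : 0 ≤ T := (le_max_right _ _).trans hT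
  have hC : 0 ≤ C * Real.exp (-κ * T) := by
    have := hb a ha T (by rw [abs_of_nonneg hT0]; exact (le_max_left _ _).trans hT)
    rw [abs_of_nonneg hT0] at this
    exact (norm_nonneg _).trans this
  let g : ℂ → ℂ := fun ζ => f (exp (θ * I) * ζ)
  have hg : ∀ ζ : ℂ, exp (θ * I) * ζ = rotatedLine θ ζ.im ζ.re := fun ζ => by
    rw [rotatedLine, re_add_im]
  have key := integral_boundary_rect_eq_zero_of_differentiable_on_off_countable g
    (-T + a * I) (T + b * I) ((fun ζ => exp (θ * I) * ζ) ⁻¹' s)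
    (hs.preimage (mul_right_injective₀ (exp_ne_zero _)))
    (fun ζ hζ => by
      have h2 : ζ.im ∈ Icc a b := by simpa [uIcc_of_le hab] using hζ.2
      refine ContinuousAt.continuousWithinAt ?_
      have : ContinuousAt f (exp (θ * I) * ζ) := by rw [hg]; exact hc _ h2 _
      exact this.comp (f := fun ζ => exp (θ * I) * ζ) (by fun_prop))
    (fun ζ hζ => by
      have h2 : ζ.im ∈ Icc a b := by
        have := hζ.1.2
        simp only [mem_preimage, hab, inf_of_le_left, sup_of_le_right, add_im, neg_im, ofReal_im,
          mul_im, ofReal_re, I_im, mul_one, I_re, mul_zero, add_zero, neg_zero, zero_add] at this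
        exact Ioo_subset_Icc_self this
      have h3 : DifferentiableAt ℂ f (exp (θ * I) * ζ) := by
        have := hζ.2
        rw [mem_preimage] at this
        rw [hg] at this ⊢
        exact hd _ h2 _ this
      exact h3.comp (f := fun ζ => exp (θ * I) * ζ) ζ (by fun_prop))
  have hside : ∀ u : ℝ, |u| = T →
      ‖∫ y in a..b, f (rotatedLine θ y u)‖ ≤ C * Real.exp (-κ * T) * (b - a) := fun u hu => by
    have := intervalIntegral.norm_integral_le_of_norm_le_const (a := a) (b := b)
      (f := fun y => f (rotatedLine θ y u)) (C := C * Real.exp (-κ * T)) fun y hy => by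
        rw [uIoc_of_le hab] at hy
        rw [← hu]
        exact hb y (Ioc_subset_Icc_self hy) u (by rw [hu]; exact (le_max_left _ _).trans hT)
    rwa [abs_of_nonneg (sub_nonneg.2 hab)] at this
  have e1 := hside T (abs_of_nonneg hT0)
  have e2 := hside (-T) (by rw [abs_neg, abs_of_nonneg hT0])
  have key' : (∫ t in (-T)..T, f (rotatedLine θ a t)) - (∫ t in (-T)..T, f (rotatedLine θ b t)) =
      I * (∫ y in a..b, f (rotatedLine θ y (-T))) - I * ∫ y in a..b, f (rotatedLine θ y T) := by
    simp only [g, add_re, neg_re, ofReal_re, mul_re, I_re, mul_zero, ofReal_im, I_im, mul_one,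
      sub_self, add_zero, add_im, neg_im, mul_im, zero_add, neg_zero, smul_eq_mul] at key
    simp only [rotatedLine]
    linear_combination key
  rw [key']
  refine (norm_sub_le _ _).trans ?_
  rw [norm_mul, norm_mul, norm_I, one_mul, one_mul]
  nlinarith [mul_nonneg hC (sub_nonneg.2 hab)]

/-- Cauchy's theorem for a double sector: the integral over a line does not change when the line
is rotated about the origin, if the integrand decays exponentially in the region swept out.
The proof is Green's theorem for `(φ, t) ↦ (f(z) e^{iφ}, -i f(z) z)` with `z = e^{iφ}(t + iε)`,
a divergence-free field. -/
theorem integral_rotatedLine_rotate {f : ℂ → ℂ} {ε φ₀ φ₁ C κ T₀ : ℝ} (h01 : φ₀ ≤ φ₁)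
    (hκ : 0 < κ)
    (hd : ∀ φ ∈ Icc φ₀ φ₁, ∀ t, DifferentiableAt ℂ f (rotatedLine φ ε t))
    (hb : ∀ φ ∈ Icc φ₀ φ₁, ∀ t, T₀ ≤ |t| → ‖f (rotatedLine φ ε t)‖ ≤ C * Real.exp (-κ * |t|)) :
    ∫ t, f (rotatedLine φ₀ ε t) * exp (φ₀ * I) = ∫ t, f (rotatedLine φ₁ ε t) * exp (φ₁ * I) := by
  have hint : ∀ φ ∈ Icc φ₀ φ₁, Integrable fun t => f (rotatedLine φ ε t) * exp (φ * I) :=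
    fun φ hφ => (integrable_of_exp_bound hκ (continuous_iff_continuousAt.2 fun t =>
      (hd φ hφ t).continuousAt.comp (continuous_rotatedLine.comp
        (by fun_prop : Continuous fun t : ℝ => ((φ, ε), t))).continuousAt) (hb φ hφ)).mul_const _
  refine integral_eq_of_interval_bound (T₀ := max T₀ 0) (C := 2 * C * (φ₁ - φ₀)) (B := |ε|) hκ
    (hint _ (left_mem_Icc.2 h01)) (hint _ (right_mem_Icc.2 h01)) fun T hT => ?_
  have hT0 : 0 ≤ T := (le_max_right _ _).trans hT
  have hC : 0 ≤ C * Real.exp (-κ * T) := by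
    have := hb φ₀ (left_mem_Icc.2 h01) T (by rw [abs_of_nonneg hT0]; exact (le_max_left _ _).trans hT)
    rw [abs_of_nonneg hT0] at this
    exact (norm_nonneg _).trans this
  let Z : ℝ × ℝ → ℂ := fun p => rotatedLine p.1 ε p.2
  let E : ℝ × ℝ → ℂ := fun p => exp (p.1 * I)
  let dφ : ℝ × ℝ →L[ℝ] ℂ := ofRealCLM.comp (ContinuousLinearMap.fst ℝ ℝ ℝ)
  let dt : ℝ × ℝ →L[ℝ] ℂ := ofRealCLM.comp (ContinuousLinearMap.snd ℝ ℝ ℝ)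
  have hφ' : ∀ p : ℝ × ℝ, HasFDerivAt (fun p : ℝ × ℝ => (p.1 : ℂ)) dφ p := fun p => dφ.hasFDerivAt
  have ht' : ∀ p : ℝ × ℝ, HasFDerivAt (fun p : ℝ × ℝ => (p.2 : ℂ)) dt p := fun p => dt.hasFDerivAt
  have hE : ∀ p, HasFDerivAt E (E p • (I • dφ)) p := fun p => by
    have := ((hφ' p).mul_const I).cexp
    exact this
  have hZ : ∀ p, HasFDerivAt Z (E p • dt + ((p.2 : ℂ) + ε * I) • (E p • (I • dφ))) p := fun p =>
    (hE p).mul ((ht' p).add_const (ε * I))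
  have hcont : ContinuousOn (fun p => f (Z p)) (Icc φ₀ φ₁ ×ˢ univ) := fun p hp =>
    ((hd p.1 hp.1 p.2).continuousAt.comp (f := Z) (hZ p).continuousAt).continuousWithinAt
  have hfZ : ∀ p : ℝ × ℝ, p.1 ∈ Icc φ₀ φ₁ → HasFDerivAt (fun p => f (Z p))
      (deriv f (Z p) • (E p • dt + ((p.2 : ℂ) + ε * I) • (E p • (I • dφ)))) p := fun p hp =>
    (hd p.1 hp p.2).hasDerivAt.comp_hasFDerivAt p (hZ p)
  have hsub : uIcc φ₀ φ₁ ×ˢ uIcc (-T) T ⊆ Icc φ₀ φ₁ ×ˢ (univ : Set ℝ) := by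
    rw [uIcc_of_le h01]; exact prod_mono Subset.rfl (subset_univ _)
  have hmem : ∀ p ∈ Ioo (min φ₀ φ₁) (max φ₀ φ₁) ×ˢ Ioo (min (-T) T) (max (-T) T),
      p.1 ∈ Icc φ₀ φ₁ := fun p hp => by
    have := hp.1
    rw [min_eq_left h01, max_eq_right h01] at this
    exact Ioo_subset_Icc_self this
  have hEc : Continuous E := continuous_iff_continuousAt.2 fun p => (hE p).continuousAt
  have hZc : Continuous Z := continuous_iff_continuousAt.2 fun p => (hZ p).continuousAt
  let F' : ℝ × ℝ → ℝ × ℝ →L[ℝ] ℂ := fun p => f (Z p) • (E p • (I • dφ)) +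
    E p • (deriv f (Z p) • (E p • dt + ((p.2 : ℂ) + ε * I) • (E p • (I • dφ))))
  let G' : ℝ × ℝ → ℝ × ℝ →L[ℝ] ℂ := fun p => (-I) • (f (Z p) • (E p • dt +
    ((p.2 : ℂ) + ε * I) • (E p • (I • dφ))) +
    Z p • (deriv f (Z p) • (E p • dt + ((p.2 : ℂ) + ε * I) • (E p • (I • dφ)))))
  -- The field is divergence free, because `∂_φ z = i z` and `∂_t z = e^{iφ}`.
  have hdiv : ∀ p, F' p (1, 0) + G' p (0, 1) = 0 := fun p => by
    simp [F', G', dφ, dt, Z, E, rotatedLine]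
    ring_nf
  have key := integral2_divergence_prod_of_hasFDerivAt
    (fun p => f (Z p) * E p) (fun p => (-I) * (f (Z p) * Z p)) F' G' φ₀ (-T) φ₁ T
    ((hcont.mono hsub).mul hEc.continuousOn)
    (((hcont.mono hsub).mul hZc.continuousOn).const_mul (-I))
    (fun p hp => (hfZ p (hmem p hp)).mul (hE p))
    (fun p hp => ((hfZ p (hmem p hp)).mul (hZ p)).const_mul (-I))
    (by simp only [hdiv]; exact integrableOn_zero)
  simp only [hdiv, intervalIntegral.integral_zero] at key
  have hside : ∀ u : ℝ, |u| = T →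
      ‖∫ y in φ₀..φ₁, (-I) * (f (Z (y, u)) * Z (y, u))‖ ≤
        C * Real.exp (-κ * T) * (T + |ε|) * (φ₁ - φ₀) := fun u hu => by
    have := intervalIntegral.norm_integral_le_of_norm_le_const (a := φ₀) (b := φ₁)
      (f := fun y => (-I) * (f (Z (y, u)) * Z (y, u)))
      (C := C * Real.exp (-κ * T) * (T + |ε|)) fun y hy => by
        rw [uIoc_of_le h01] at hy
        rw [norm_mul, norm_mul, norm_neg, norm_I, one_mul, ← hu]
        refine mul_le_mul (hb y (Ioc_subset_Icc_self hy) u ?_) (norm_rotatedLine_le _ _ _)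
          (norm_nonneg _) (by rw [hu]; exact hC)
        rw [hu]; exact (le_max_left _ _).trans hT
    rwa [abs_of_nonneg (sub_nonneg.2 h01)] at this
  have e1 := hside T (abs_of_nonneg hT0)
  have e2 := hside (-T) (by rw [abs_neg, abs_of_nonneg hT0])
  have key' : (∫ t in (-T)..T, f (rotatedLine φ₀ ε t) * exp (φ₀ * I)) -
      (∫ t in (-T)..T, f (rotatedLine φ₁ ε t) * exp (φ₁ * I)) =
      (∫ y in φ₀..φ₁, (-I) * (f (Z (y, T)) * Z (y, T))) -
        ∫ y in φ₀..φ₁, (-I) * (f (Z (y, -T)) * Z (y, -T)) := by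
    simp only [Z, E] at key ⊢
    linear_combination key
  rw [key']
  refine (norm_sub_le _ _).trans ?_
  linarith

/-- On an arc of length less than `π`, a positive value of `Re (u e^{iφ})` is at least the smaller
of its values at the ends of the arc. -/
lemma min_le_re_mul_exp {u : ℂ} {φ₀ φ₁ φ m : ℝ} (hm : 0 ≤ m) (hπ : φ₁ - φ₀ < Real.pi)
    (hφ : φ ∈ Icc φ₀ φ₁) (h0 : m ≤ (u * exp (φ₀ * I)).re) (h1 : m ≤ (u * exp (φ₁ * I)).re) :
    m ≤ (u * exp (φ * I)).re := by
  have hre : ∀ x : ℝ, (u * exp (x * I)).re = u.re * Real.cos x - u.im * Real.sin x := fun x => by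
    rw [mul_re, exp_ofReal_mul_I_re, exp_ofReal_mul_I_im]
  rcases eq_or_lt_of_le (hφ.1.trans hφ.2) with h | h
  · have : φ = φ₀ := le_antisymm (h ▸ hφ.2) hφ.1
    rwa [this]
  have hs : 0 < Real.sin (φ₁ - φ₀) := Real.sin_pos_of_pos_of_lt_pi (by linarith) hπ
  have hx : 0 ≤ Real.sin (φ₁ - φ) :=
    Real.sin_nonneg_of_nonneg_of_le_pi (by linarith [hφ.2]) (by linarith [hφ.1])
  have hy : 0 ≤ Real.sin (φ - φ₀) :=
    Real.sin_nonneg_of_nonneg_of_le_pi (by linarith [hφ.1]) (by linarith [hφ.2])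
  have hadd : Real.sin (φ₁ - φ₀) ≤ Real.sin (φ₁ - φ) + Real.sin (φ - φ₀) := by
    have : φ₁ - φ₀ = (φ₁ - φ) + (φ - φ₀) := by ring
    rw [this, Real.sin_add]
    nlinarith [Real.cos_le_one (φ₁ - φ), Real.cos_le_one (φ - φ₀)]
  -- `e^{iφ}` is a combination of `e^{iφ₀}` and `e^{iφ₁}` with nonnegative coefficients.
  have hid : Real.sin (φ₁ - φ₀) * (u * exp (φ * I)).re =
      Real.sin (φ₁ - φ) * (u * exp (φ₀ * I)).re + Real.sin (φ - φ₀) * (u * exp (φ₁ * I)).re := by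
    simp only [hre, Real.sin_sub]
    ring
  nlinarith

/-! ### Bounds along the lines of integration -/

lemma abs_sinh_re_le_norm_sinh (u : ℂ) : Real.sinh |u.re| ≤ ‖sinh u‖ := by
  have h := abs_norm_sub_norm_le (exp u) (exp (-u))
  rw [norm_exp, norm_exp, neg_re] at h
  have h2 : ‖sinh u‖ = ‖exp u - exp (-u)‖ / 2 := by rw [sinh, norm_div]; simp
  have h3 : Real.sinh |u.re| = |Real.exp u.re - Real.exp (-u.re)| / 2 := by
    rw [← Real.abs_sinh, Real.sinh_eq, abs_div, abs_two]
  rw [h2, h3]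
  linarith

lemma sinh_ne_zero_of_re_ne_zero {u : ℂ} (hu : u.re ≠ 0) : sinh u ≠ 0 := fun h => by
  have := abs_sinh_re_le_norm_sinh u
  rw [h, norm_zero] at this
  exact absurd this (not_le.2 (Real.sinh_pos_iff.2 (abs_pos.2 hu)))

lemma exp_div_four_le_norm_sinh {u : ℂ} (hu : 1 ≤ |u.re|) :
    Real.exp |u.re| / 4 ≤ ‖sinh u‖ := by
  refine le_trans ?_ (abs_sinh_re_le_norm_sinh u)
  rw [Real.sinh_eq]
  have h1 : 2 ≤ Real.exp |u.re| := by linarith [Real.add_one_le_exp |u.re|]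
  have h2 : Real.exp (-|u.re|) ≤ 1 := Real.exp_le_one_iff.2 (by linarith)
  have h3 : Real.exp |u.re| * Real.exp (-|u.re|) = 1 := by rw [← Real.exp_add]; simp
  nlinarith [Real.exp_pos (-|u.re|)]

lemma re_mul_rotatedLine (a : ℂ) (φ ε t : ℝ) :
    (a * rotatedLine φ ε t).re = t * (a * exp (φ * I)).re - ε * (a * exp (φ * I)).im := by
  rw [rotatedLine, ← mul_assoc]
  simp only [mul_re (a * exp (φ * I)), add_re, add_im, ofReal_re, ofReal_im, mul_re, mul_im, I_re, I_im]
  ring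

lemma im_mul_rotatedLine (a : ℂ) (φ ε t : ℝ) :
    (a * rotatedLine φ ε t).im = t * (a * exp (φ * I)).im + ε * (a * exp (φ * I)).re := by
  rw [rotatedLine, ← mul_assoc]
  simp only [mul_im (a * exp (φ * I)), add_re, add_im, ofReal_re, ofReal_im, mul_re, mul_im, I_re, I_im]
  ring

lemma norm_mul_exp_mul_I (a : ℂ) (φ : ℝ) : ‖a * exp (φ * I)‖ = ‖a‖ := by
  rw [norm_mul, norm_exp_ofReal_mul_I, mul_one]

lemma norm_exp_mul_rotatedLine_le (w : ℂ) (φ ε t : ℝ) :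
    ‖exp (w * rotatedLine φ ε t)‖ ≤
      Real.exp (|(w * exp (φ * I)).re| * |t|) * Real.exp (|ε| * ‖w‖) := by
  rw [norm_exp, re_mul_rotatedLine, ← Real.exp_add, Real.exp_le_exp]
  have h1 := le_abs_self (t * (w * exp (φ * I)).re)
  have h2 := neg_abs_le (ε * (w * exp (φ * I)).im)
  have h3 := abs_im_le_norm (w * exp (φ * I))
  rw [norm_mul_exp_mul_I] at h3
  rw [abs_mul] at h1 h2
  nlinarith [mul_le_mul_of_nonneg_left h3 (abs_nonneg ε)]

/-- Away from the origin `1 / sinh (a z)` decays exponentially, uniformly for lines whose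
parameters range over a compact set. -/
lemma exists_csch_bound_far (a : ℂ) {K : Set (ℝ × ℝ)} (hK : IsCompact K)
    (hpos : ∀ p ∈ K, 0 < (a * exp (p.1 * I)).re) :
    ∃ C T₀ : ℝ, 0 ≤ C ∧ 0 ≤ T₀ ∧ ∀ p ∈ K, ∀ t : ℝ, T₀ ≤ |t| →
      ‖(sinh (a * rotatedLine p.1 p.2 t))⁻¹‖ ≤ C * Real.exp (-((a * exp (p.1 * I)).re * |t|)) := by
  obtain ⟨r, hr, hrK⟩ := hK.exists_forall_le' (f := fun p : ℝ × ℝ => (a * exp (p.1 * I)).re)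
    (by fun_prop) hpos
  obtain ⟨M, hM⟩ := hK.exists_bound_of_continuousOn
    (f := fun p : ℝ × ℝ => p.2 * (a * exp (p.1 * I)).im) (by fun_prop)
  refine ⟨4 * Real.exp |M|, (1 + |M|) / r, by positivity, by positivity, fun p hp t ht => ?_⟩
  have h1 := hM p hp
  have h2 := hrK p hp
  set R := (a * exp (p.1 * I)).re
  have hre := re_mul_rotatedLine a p.1 p.2 t
  have h3 : R * |t| - |M| ≤ |(a * rotatedLine p.1 p.2 t).re| := by
    rw [hre]
    have := abs_sub_abs_le_abs_sub (t * R) (p.2 * (a * exp (p.1 * I)).im)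
    rw [abs_mul, abs_of_pos (hr.trans_le h2)] at this
    rw [Real.norm_eq_abs] at h1
    linarith [le_abs_self M]
  have h4 : 1 + |M| ≤ R * |t| := by
    rw [div_le_iff₀ hr] at ht
    nlinarith [abs_nonneg t]
  have h5 := exp_div_four_le_norm_sinh (u := a * rotatedLine p.1 p.2 t) (by linarith)
  have h6 : Real.exp (R * |t| - |M|) / 4 ≤ ‖sinh (a * rotatedLine p.1 p.2 t)‖ :=
    le_trans (by gcongr) h5
  rw [norm_inv]
  refine (inv_anti₀ (by positivity) h6).trans (le_of_eq ?_)
  rw [Real.exp_sub, Real.exp_neg]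
  field_simp

lemma exists_csch_bound (a : ℂ) {K : Set (ℝ × ℝ)} (hK : IsCompact K)
    (hpos : ∀ p ∈ K, 0 < (a * exp (p.1 * I)).re)
    (hne : ∀ p ∈ K, ∀ t, sinh (a * rotatedLine p.1 p.2 t) ≠ 0) :
    ∃ C : ℝ, 0 ≤ C ∧ ∀ p ∈ K, ∀ t : ℝ,
      ‖(sinh (a * rotatedLine p.1 p.2 t))⁻¹‖ ≤ C * Real.exp (-((a * exp (p.1 * I)).re * |t|)) := by
  obtain ⟨C, T, hC, hT, hfar⟩ := exists_csch_bound_far a hK hpos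
  obtain ⟨D, hD⟩ := (hK.prod (isCompact_Icc (a := -T) (b := T))).exists_bound_of_continuousOn
    (f := fun q : (ℝ × ℝ) × ℝ => (sinh (a * rotatedLine q.1.1 q.1.2 q.2))⁻¹ *
      (Real.exp ((a * exp (q.1.1 * I)).re * |q.2|) : ℂ)) (by
      refine ContinuousOn.mul (ContinuousOn.inv₀ ?_ fun q hq => hne _ hq.1 _) (by fun_prop)
      exact (continuous_sinh.comp (continuous_const.mul continuous_rotatedLine)).continuousOn)
  refine ⟨max C D, le_max_of_le_left hC, fun p hp t => ?_⟩
  rcases le_total T |t| with h | h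
  · refine (hfar p hp t h).trans ?_
    gcongr
    exact le_max_left _ _
  · have := hD (p, t) ⟨hp, abs_le.1 h⟩
    rw [norm_mul, norm_real, Real.norm_eq_abs, Real.abs_exp] at this
    rw [Real.exp_neg, ← div_eq_mul_inv, le_div_iff₀ (Real.exp_pos _)]
    exact this.trans (le_max_right _ _)

/-- The line `e^{iφ}(ℝ + iε)` passes between the poles `0` and `iπ / a` of `1 / sinh (a z)`. -/
lemma sinh_mul_rotatedLine_ne_zero {a : ℂ} {φ ε : ℝ} (hpos : 0 < (a * exp (φ * I)).re)
    (hε : 0 < ε) (hε' : ε * ‖a‖ ^ 2 < Real.pi * (a * exp (φ * I)).re) (t : ℝ) :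
    sinh (a * rotatedLine φ ε t) ≠ 0 := by
  intro h
  have h' : sin (a * rotatedLine φ ε t * I) = 0 := by rw [sin_mul_I, h, zero_mul]
  obtain ⟨k, hk⟩ := Complex.sin_eq_zero_iff.1 h'
  have hre := congrArg re hk
  have him := congrArg im hk
  rw [mul_I_re, im_mul_rotatedLine] at hre
  rw [mul_I_im, re_mul_rotatedLine] at him
  have hn : ‖a‖ ^ 2 = (a * exp (φ * I)).re ^ 2 + (a * exp (φ * I)).im ^ 2 := by
    rw [← norm_mul_exp_mul_I a φ, ← normSq_eq_norm_sq, normSq_apply]; ring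
  rw [hn] at hε'
  set x := (a * exp (φ * I)).re
  set y := (a * exp (φ * I)).im
  have hre' : -(t * y + ε * x) = k * Real.pi := by simpa using hre
  have him' : t * x - ε * y = 0 := by simpa using him
  -- The bounds on `ε` place `ε |a|²` strictly between two consecutive multiples of `π Re (a e^{iφ})`.
  have e1 : ε * (x ^ 2 + y ^ 2) = -k * (Real.pi * x) := by linear_combination (-x) * hre' + (-y) * him'
  have hπx : 0 < Real.pi * x := mul_pos Real.pi_pos hpos
  have k0 : (0 : ℝ) < -k := by
    by_contra hcon
    have : 0 < ε * (x ^ 2 + y ^ 2) := by positivity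
    nlinarith
  have k1 : (-k : ℝ) < 1 := by
    by_contra hcon
    nlinarith
  have a1 : (0 : ℤ) < -k := by exact_mod_cast k0
  have a2 : (-k : ℤ) < 1 := by exact_mod_cast k1
  omega

lemma pi_mul_exp_re (φ : ℝ) : ((Real.pi : ℂ) * exp (φ * I)).re = Real.pi * Real.cos φ := by
  rw [re_ofReal_mul, exp_ofReal_mul_I_re]

lemma sinh_pi_mul_rotatedLine_ne_zero {φ ε : ℝ} (hε : 0 < ε) (hε' : ε < Real.cos φ) (t : ℝ) :
    sinh (Real.pi * rotatedLine φ ε t) ≠ 0 := by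
  have hπ := Real.pi_pos
  refine sinh_mul_rotatedLine_ne_zero ?_ hε ?_ t
  · rw [pi_mul_exp_re]; exact mul_pos hπ (hε.trans hε')
  · rw [pi_mul_exp_re, norm_real, Real.norm_eq_abs, sq_abs]
    nlinarith [mul_pos hπ hπ]

/-- Powers of `z` are absorbed by an arbitrarily slow exponential. -/
lemma exists_zpow_bound {κ d : ℝ} (hκ : 0 < κ) (hd : 0 < d) (E : ℝ) (j : ℤ) :
    ∃ C : ℝ, 0 ≤ C ∧ ∀ φ ε t : ℝ, |ε| ≤ E → d ≤ ‖rotatedLine φ ε t‖ →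
      ‖rotatedLine φ ε t ^ j‖ ≤ C * Real.exp (κ * |t|) := by
  obtain ⟨n, rfl | rfl⟩ := j.eq_nat_or_neg
  · have hκ' : 0 < κ / (n + 1) := by positivity
    refine ⟨(1 / (κ / (n + 1)) + |E|) ^ n, by positivity, fun φ ε t hε _ => ?_⟩
    rw [zpow_natCast, norm_pow]
    have h1 : ‖rotatedLine φ ε t‖ ≤
        (1 / (κ / (n + 1)) + |E|) * Real.exp (κ / (n + 1) * |t|) := by
      have e1 := Real.add_one_le_exp (κ / (n + 1) * |t|)
      have e2 : 1 ≤ Real.exp (κ / (n + 1) * |t|) := Real.one_le_exp (by positivity)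
      have e3 : |t| ≤ 1 / (κ / (n + 1)) * Real.exp (κ / (n + 1) * |t|) := by
        rw [one_div, inv_mul_eq_div, le_div_iff₀ hκ']; linarith
      have e4 := norm_rotatedLine_le φ ε t
      have e5 := le_abs_self E
      nlinarith [abs_nonneg E]
    calc ‖rotatedLine φ ε t‖ ^ n
        ≤ ((1 / (κ / (n + 1)) + |E|) * Real.exp (κ / (n + 1) * |t|)) ^ n := by gcongr
      _ = (1 / (κ / (n + 1)) + |E|) ^ n * Real.exp (n * (κ / (n + 1) * |t|)) := by
          rw [mul_pow, ← Real.exp_nat_mul]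
      _ ≤ _ := by
          have h2 : (n : ℝ) * (κ / (n + 1) * |t|) ≤ κ * |t| := by
            rw [← mul_assoc, mul_div_left_comm]
            refine mul_le_mul_of_nonneg_right ?_ (abs_nonneg t)
            exact mul_le_of_le_one_right hκ.le ((div_le_one (by positivity)).2 (by linarith))
          gcongr
  · refine ⟨(d⁻¹) ^ n, by positivity, fun φ ε t _ h => ?_⟩
    rw [zpow_neg, zpow_natCast, norm_inv, norm_pow, ← inv_pow]
    have e2 : 1 ≤ Real.exp (κ * |t|) := Real.one_le_exp (by positivity)
    have e3 : (‖rotatedLine φ ε t‖⁻¹) ^ n ≤ (d⁻¹) ^ n := by gcongr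
    exact e3.trans (le_mul_of_one_le_right (by positivity) e2)

/-! ### Independence of the contour -/

lemma re_mul_exp_sub_abs_continuous (u w : ℂ) :
    Continuous fun p : ℝ × ℝ => (u * exp (p.1 * I)).re - |(w * exp (p.1 * I)).re| := by
  fun_prop

lemma FaddeevAdmissible.sinh_ne {γ w : ℂ} {φ ε : ℝ} (h : FaddeevAdmissible γ w φ ε) (t : ℝ) :
    sinh (γ * rotatedLine φ ε t) ≠ 0 :=
  sinh_mul_rotatedLine_ne_zero h.re_pos h.eps_pos h.eps_lt' t

lemma rotatedLine_ne_zero {φ ε : ℝ} (hε : 0 < ε) (t : ℝ) : rotatedLine φ ε t ≠ 0 :=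
  norm_pos_iff.1 ((abs_pos.2 hε.ne').trans_le (abs_le_norm_rotatedLine' φ ε t))

lemma differentiableAt_faddeevIntegrand {γ w z : ℂ} (h0 : z ≠ 0) (h1 : sinh (Real.pi * z) ≠ 0)
    (h2 : sinh (γ * z) ≠ 0) : DifferentiableAt ℂ (faddeevIntegrand γ w) z := by
  unfold faddeevIntegrand
  exact DifferentiableAt.mul (DifferentiableAt.div (by fun_prop) (by fun_prop) (mul_ne_zero h1 h0))
    (DifferentiableAt.div (by fun_prop) (by fun_prop) h2)

lemma FaddeevAdmissible.differentiableAt {γ w : ℂ} {φ ε : ℝ} (h : FaddeevAdmissible γ w φ ε)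
    (t : ℝ) : DifferentiableAt ℂ (faddeevIntegrand γ w) (rotatedLine φ ε t) :=
  differentiableAt_faddeevIntegrand (rotatedLine_ne_zero h.eps_pos t)
    (sinh_pi_mul_rotatedLine_ne_zero h.eps_pos h.eps_lt t) (h.sinh_ne t)

lemma exists_faddeevIntegrand_bound {γ w : ℂ} {K : Set (ℝ × ℝ)} (hK : IsCompact K)
    (hadm : ∀ p ∈ K, FaddeevAdmissible γ w p.1 p.2) :
    ∃ C κ : ℝ, 0 < κ ∧ ∀ p ∈ K, ∀ t : ℝ,
      ‖faddeevIntegrand γ w (rotatedLine p.1 p.2 t)‖ ≤ C * Real.exp (-κ * |t|) := by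
  obtain ⟨A, hA, hA'⟩ := exists_csch_bound Real.pi hK
    (fun p hp => by
      rw [pi_mul_exp_re]
      exact mul_pos Real.pi_pos ((hadm p hp).eps_pos.trans (hadm p hp).eps_lt))
    (fun p hp => sinh_pi_mul_rotatedLine_ne_zero (hadm p hp).eps_pos (hadm p hp).eps_lt)
  obtain ⟨B, hB, hB'⟩ := exists_csch_bound γ hK (fun p hp => (hadm p hp).re_pos)
    (fun p hp => (hadm p hp).sinh_ne)
  obtain ⟨κ, hκ, hκ'⟩ := hK.exists_forall_le'
    (re_mul_exp_sub_abs_continuous (Real.pi + γ) w).continuousOn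
    (fun p hp => sub_pos.2 (hadm p hp).decay)
  obtain ⟨d, hd, hd'⟩ := hK.exists_forall_le' (f := fun p : ℝ × ℝ => p.2) (by fun_prop)
    (fun p hp => (hadm p hp).eps_pos)
  obtain ⟨M, hM⟩ := hK.exists_bound_of_continuousOn (f := fun p : ℝ × ℝ => p.2) (by fun_prop)
  refine ⟨Real.exp (M * ‖w‖) * A * B * d⁻¹, κ, hκ, fun p hp t => ?_⟩
  have h1 := norm_exp_mul_rotatedLine_le w p.1 p.2 t
  have h2 := hA' p hp t
  have h3 := hB' p hp t
  have h4 : ‖(rotatedLine p.1 p.2 t)⁻¹‖ ≤ d⁻¹ := by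
    rw [norm_inv]
    exact inv_anti₀ hd ((hd' p hp).trans ((le_abs_self _).trans (abs_le_norm_rotatedLine' _ _ _)))
  have h5 := hM p hp
  rw [Real.norm_eq_abs] at h5
  have h6 := hκ' p hp
  have e : faddeevIntegrand γ w (rotatedLine p.1 p.2 t) = exp (w * rotatedLine p.1 p.2 t) *
      (sinh (Real.pi * rotatedLine p.1 p.2 t))⁻¹ * (sinh (γ * rotatedLine p.1 p.2 t))⁻¹ *
      (rotatedLine p.1 p.2 t)⁻¹ := by
    rw [faddeevIntegrand, div_eq_mul_inv, mul_inv, one_div]; ring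
  rw [e, norm_mul, norm_mul, norm_mul]
  calc _ ≤ (Real.exp (|(w * exp (p.1 * I)).re| * |t|) * Real.exp (M * ‖w‖)) *
        (A * Real.exp (-(((Real.pi : ℂ) * exp (p.1 * I)).re * |t|))) *
        (B * Real.exp (-((γ * exp (p.1 * I)).re * |t|))) * d⁻¹ := by
        gcongr
        exact h1.trans (by gcongr)
    _ = Real.exp (M * ‖w‖) * A * B * d⁻¹ *
        Real.exp (-(((Real.pi + γ) * exp (p.1 * I)).re - |(w * exp (p.1 * I)).re|) * |t|) := by
        rw [add_mul, add_re]
        have : -((((Real.pi : ℂ) * exp (p.1 * I)).re + (γ * exp (p.1 * I)).re) -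
            |(w * exp (p.1 * I)).re|) * |t| = |(w * exp (p.1 * I)).re| * |t| +
            (-(((Real.pi : ℂ) * exp (p.1 * I)).re * |t|) + -((γ * exp (p.1 * I)).re * |t|)) := by
          ring
        rw [this, Real.exp_add, Real.exp_add]
        ring
    _ ≤ _ := by gcongr

lemma FaddeevAdmissible.integrable {γ w : ℂ} {φ ε : ℝ} (h : FaddeevAdmissible γ w φ ε) :
    Integrable fun t : ℝ => faddeevIntegrand γ w (rotatedLine φ ε t) := by
  obtain ⟨C, κ, hκ, hb⟩ := exists_faddeevIntegrand_bound (γ := γ) (w := w)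
    (isCompact_singleton (x := (φ, ε))) (by rintro p rfl; exact h)
  refine integrable_of_exp_bound (T₀ := 0) hκ (continuous_iff_continuousAt.2 fun t => ?_)
    fun t _ => hb _ rfl t
  exact (h.differentiableAt t).continuousAt.comp (continuous_rotatedLine.comp
    (by fun_prop : Continuous fun t : ℝ => ((φ, ε), t))).continuousAt

lemma FaddeevAdmissible.mono {γ w : ℂ} {φ ε ε' : ℝ} (h : FaddeevAdmissible γ w φ ε)
    (h0 : 0 < ε') (h1 : ε' ≤ ε) : FaddeevAdmissible γ w φ ε' :=
  ⟨h.angle_gt, h.angle_lt, h.re_pos, h.decay, h0, h1.trans_lt h.eps_lt,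
    (mul_le_mul_of_nonneg_right h1 (by positivity)).trans_lt h.eps_lt'⟩

lemma lt_re_mul_exp {u : ℂ} {φ₀ φ₁ φ m : ℝ} (hm : 0 ≤ m) (hπ : φ₁ - φ₀ < Real.pi)
    (hφ : φ ∈ Icc φ₀ φ₁) (h0 : m < (u * exp (φ₀ * I)).re) (h1 : m < (u * exp (φ₁ * I)).re) :
    m < (u * exp (φ * I)).re :=
  (lt_min h0 h1).trans_le (min_le_re_mul_exp (hm.trans (lt_min h0 h1).le) hπ hφ (min_le_left _ _)
    (min_le_right _ _))

/-- The decay condition as two positivity conditions of the form preserved on an arc. -/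
lemma abs_re_lt_iff {u w : ℂ} {φ : ℝ} : |(w * exp (φ * I)).re| < (u * exp (φ * I)).re ↔
    0 < ((u - w) * exp (φ * I)).re ∧ 0 < ((u + w) * exp (φ * I)).re := by
  rw [sub_mul, add_mul, sub_re, add_re, abs_lt]
  constructor <;> rintro ⟨h1, h2⟩ <;> constructor <;> linarith

/-- For a fixed distance `ε` the admissible angles form an interval. -/
lemma FaddeevAdmissible.of_mem_Icc {γ w : ℂ} {φ₀ φ₁ φ ε : ℝ} (h0 : FaddeevAdmissible γ w φ₀ ε)
    (h1 : FaddeevAdmissible γ w φ₁ ε) (hφ : φ ∈ Icc φ₀ φ₁) : FaddeevAdmissible γ w φ ε := by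
  have hπ : φ₁ - φ₀ < Real.pi := by linarith [h0.angle_gt, h1.angle_lt]
  have hcos : ∀ x : ℝ, Real.cos x = ((1 : ℂ) * exp (x * I)).re := fun x => by
    rw [one_mul, exp_ofReal_mul_I_re]
  have d0 := abs_re_lt_iff.1 h0.decay
  have d1 := abs_re_lt_iff.1 h1.decay
  refine ⟨by linarith [h0.angle_gt, hφ.1], by linarith [h1.angle_lt, hφ.2],
    lt_re_mul_exp le_rfl hπ hφ h0.re_pos h1.re_pos,
    abs_re_lt_iff.2 ⟨lt_re_mul_exp le_rfl hπ hφ d0.1 d1.1, lt_re_mul_exp le_rfl hπ hφ d0.2 d1.2⟩,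
    h0.eps_pos, ?_, ?_⟩
  · rw [hcos]
    exact lt_re_mul_exp h0.eps_pos.le hπ hφ (hcos φ₀ ▸ h0.eps_lt) (hcos φ₁ ▸ h1.eps_lt)
  · rw [mul_comm Real.pi, ← div_lt_iff₀ Real.pi_pos]
    refine lt_re_mul_exp (div_nonneg (mul_nonneg h0.eps_pos.le (by positivity)) Real.pi_pos.le)
      hπ hφ ?_ ?_
    · rw [div_lt_iff₀ Real.pi_pos, mul_comm _ Real.pi]; exact h0.eps_lt'
    · rw [div_lt_iff₀ Real.pi_pos, mul_comm _ Real.pi]; exact h1.eps_lt'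

lemma FaddeevAdmissible.contourIntegral_eq_of_le {γ w : ℂ} {φ ε ε' : ℝ}
    (h : FaddeevAdmissible γ w φ ε) (h0 : 0 < ε') (h1 : ε' ≤ ε) :
    faddeevContourIntegral φ ε' γ w = faddeevContourIntegral φ ε γ w := by
  have hadm : ∀ x ∈ Icc ε' ε, FaddeevAdmissible γ w φ x := fun x hx =>
    h.mono (h0.trans_le hx.1) hx.2
  obtain ⟨C, κ, hκ, hb⟩ := exists_faddeevIntegrand_bound (γ := γ) (w := w)
    ((isCompact_singleton (x := φ)).prod (isCompact_Icc (a := ε') (b := ε)))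
    (by rintro ⟨a, b⟩ ⟨rfl, hb⟩; exact hadm b hb)
  have := integral_rotatedLine_shift (f := faddeevIntegrand γ w) (θ := φ) (T₀ := 0) h1 hκ
    countable_empty (fun x hx t => ((hadm x hx).differentiableAt t).continuousAt)
    (fun x hx t _ => (hadm x hx).differentiableAt t)
    (fun x hx t _ => hb (φ, x) ⟨rfl, hx⟩ t)
  rw [faddeevContourIntegral, faddeevContourIntegral, integral_mul_const, integral_mul_const, this]

theorem FaddeevAdmissible.contourIntegral_eq {γ w : ℂ} {φ₀ φ₁ ε₀ ε₁ : ℝ}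
    (h0 : FaddeevAdmissible γ w φ₀ ε₀) (h1 : FaddeevAdmissible γ w φ₁ ε₁) :
    faddeevContourIntegral φ₀ ε₀ γ w = faddeevContourIntegral φ₁ ε₁ γ w := by
  wlog h : φ₀ ≤ φ₁ generalizing φ₀ φ₁ ε₀ ε₁
  · exact (this h1 h0 (le_of_not_ge h)).symm
  have hε : 0 < min ε₀ ε₁ := lt_min h0.eps_pos h1.eps_pos
  rw [← h0.contourIntegral_eq_of_le hε (min_le_left _ _),
    ← h1.contourIntegral_eq_of_le hε (min_le_right _ _)]
  have hadm : ∀ x ∈ Icc φ₀ φ₁, FaddeevAdmissible γ w x (min ε₀ ε₁) := fun x hx =>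
    (h0.mono hε (min_le_left _ _)).of_mem_Icc (h1.mono hε (min_le_right _ _)) hx
  obtain ⟨C, κ, hκ, hb⟩ := exists_faddeevIntegrand_bound (γ := γ) (w := w)
    ((isCompact_Icc (a := φ₀) (b := φ₁)).prod (isCompact_singleton (x := min ε₀ ε₁)))
    (by rintro ⟨a, b⟩ ⟨ha, rfl⟩; exact hadm a ha)
  exact integral_rotatedLine_rotate (T₀ := 0) h hκ (fun x hx t => (hadm x hx).differentiableAt t)
    (fun x hx t _ => hb (x, _) ⟨hx, rfl⟩ t)

lemma FaddeevAdmissible.contourIntegral_eq_faddeevG {γ w : ℂ} {φ ε : ℝ}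
    (h : FaddeevAdmissible γ w φ ε) : faddeevContourIntegral φ ε γ w = faddeevG γ w := by
  have hex : ∃ p : ℝ × ℝ, FaddeevAdmissible γ w p.1 p.2 := ⟨(φ, ε), h⟩
  rw [faddeevG, dif_pos hex]
  exact h.contourIntegral_eq hex.choose_spec

/-! ### The integrals of `e^{wz} z^j / sinh (π z)` -/

/-- The function `e^{wz} z^j / sinh (π z)`, obtained from the integrand of `g_γ` by replacing
`1 / sinh (γ z)` with a power of `z`. -/
noncomputable def dilogKernel (j : ℤ) (w z : ℂ) : ℂ := exp (w * z) * z ^ j * (sinh (Real.pi * z))⁻¹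

/-- The integral of `dilogKernel j w` along the line `e^{iθ}(ℝ + iε)`, as a function of `w`. -/
noncomputable def dilogMoment (θ ε : ℝ) (j : ℤ) (w : ℂ) : ℂ :=
  ∫ t : ℝ, dilogKernel j w (rotatedLine θ ε t) * exp (θ * I)

/-- The open strip `|Re (w e^{iθ})| < π cos θ`, on which the integrals `dilogMoment θ ε j w`
converge. -/
def dilogStrip (θ : ℝ) : Set ℂ := {w | |(w * exp (θ * I)).re| < Real.pi * Real.cos θ}

lemma isOpen_dilogStrip (θ : ℝ) : IsOpen (dilogStrip θ) :=
  isOpen_lt (by fun_prop) continuous_const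

lemma convex_dilogStrip (θ : ℝ) : Convex ℝ (dilogStrip θ) := by
  intro x hx y hy a b ha hb hab
  simp only [dilogStrip, mem_ofPred_eq, abs_lt] at hx hy ⊢
  have : ((a • x + b • y) * exp (θ * I)).re =
      a * (x * exp (θ * I)).re + b * (y * exp (θ * I)).re := by
    simp only [real_smul, add_mul, mul_assoc, add_re, re_ofReal_mul]
  rw [this]
  obtain rfl : b = 1 - a := by linarith
  rcases eq_or_lt_of_le ha with rfl | ha
  · simpa using hy
  · constructor <;> nlinarith

lemma neg_mem_dilogStrip {θ : ℝ} {w : ℂ} (hw : w ∈ dilogStrip θ) : -w ∈ dilogStrip θ := by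
  rwa [dilogStrip, mem_ofPred_eq, neg_mul, neg_re, abs_neg]

lemma zero_mem_dilogStrip {θ : ℝ} (hθ : 0 < Real.cos θ) : (0 : ℂ) ∈ dilogStrip θ := by
  simpa [dilogStrip] using mul_pos Real.pi_pos hθ

lemma continuous_rotatedLine_apply (φ ε : ℝ) : Continuous fun t => rotatedLine φ ε t :=
  continuous_rotatedLine.comp (by fun_prop : Continuous fun t : ℝ => ((φ, ε), t))

/-- The kernel decays exponentially once the factors `e^{wz}` and `z^j` are controlled. -/
lemma norm_dilogKernel_le {θ ε t A B E M ρ : ℝ} {j : ℤ} {w : ℂ} (hB : 0 ≤ B) (hε : |ε| ≤ E)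
    (hw : |(w * exp (θ * I)).re| ≤ ρ) (hM : ‖w‖ ≤ M)
    (hA : ‖(sinh (Real.pi * rotatedLine θ ε t))⁻¹‖ ≤
      A * Real.exp (-(((Real.pi : ℂ) * exp (θ * I)).re * |t|)))
    (hj : ‖rotatedLine θ ε t ^ j‖ ≤ B * Real.exp ((Real.pi * Real.cos θ - ρ) / 2 * |t|)) :
    ‖dilogKernel j w (rotatedLine θ ε t)‖ ≤
      Real.exp (E * M) * B * A * Real.exp (-((Real.pi * Real.cos θ - ρ) / 2) * |t|) := by
  have hE : 0 ≤ E := (abs_nonneg _).trans hε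
  have h1 := norm_exp_mul_rotatedLine_le w θ ε t
  rw [pi_mul_exp_re] at hA
  rw [dilogKernel, norm_mul, norm_mul]
  calc _ ≤ (Real.exp (ρ * |t|) * Real.exp (E * M)) *
        (B * Real.exp ((Real.pi * Real.cos θ - ρ) / 2 * |t|)) *
        (A * Real.exp (-(Real.pi * Real.cos θ * |t|))) := by
        gcongr
        exact h1.trans (by gcongr)
    _ = _ := by
        have : -((Real.pi * Real.cos θ - ρ) / 2) * |t| = ρ * |t| +
            ((Real.pi * Real.cos θ - ρ) / 2 * |t| + -(Real.pi * Real.cos θ * |t|)) := by ring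
        rw [this, Real.exp_add, Real.exp_add]
        ring

lemma exists_dilogKernel_bound {θ ε ρ : ℝ} (hε : 0 < ε) (hε' : ε < Real.cos θ)
    (hρ : ρ < Real.pi * Real.cos θ) (M : ℝ) (j : ℤ) :
    ∃ C κ : ℝ, 0 < κ ∧ ∀ w : ℂ, |(w * exp (θ * I)).re| ≤ ρ → ‖w‖ ≤ M → ∀ t : ℝ,
      ‖dilogKernel j w (rotatedLine θ ε t)‖ ≤ C * Real.exp (-κ * |t|) := by
  obtain ⟨A, hA, hA'⟩ := exists_csch_bound Real.pi (isCompact_singleton (x := (θ, ε)))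
    (by rintro p rfl; rw [pi_mul_exp_re]; exact mul_pos Real.pi_pos (hε.trans hε'))
    (by rintro p rfl; exact sinh_pi_mul_rotatedLine_ne_zero hε hε')
  have hκ : 0 < (Real.pi * Real.cos θ - ρ) / 2 := by linarith
  obtain ⟨B, hB, hB'⟩ := exists_zpow_bound hκ hε ε j
  exact ⟨Real.exp (ε * M) * B * A, (Real.pi * Real.cos θ - ρ) / 2, hκ, fun w hw hM t =>
    norm_dilogKernel_le hB (abs_of_pos hε).le hw hM (hA' _ rfl t)
      (hB' θ ε t (abs_of_pos hε).le ((le_abs_self _).trans (abs_le_norm_rotatedLine' _ _ _)))⟩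

/-- Decay of the kernel away from the origin, for lines at bounded distance from the origin,
whatever the position of the poles. -/
lemma exists_dilogKernel_bound_far {θ a b : ℝ} (hθ : 0 < Real.cos θ) {w : ℂ}
    (hw : w ∈ dilogStrip θ) (j : ℤ) :
    ∃ C κ T₀ : ℝ, 0 < κ ∧ 1 ≤ T₀ ∧ ∀ ε ∈ Icc a b, ∀ t : ℝ, T₀ ≤ |t| →
      ‖dilogKernel j w (rotatedLine θ ε t)‖ ≤ C * Real.exp (-κ * |t|) := by
  obtain ⟨A, T, hA, hT, hA'⟩ := exists_csch_bound_far Real.pi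
    ((isCompact_singleton (x := θ)).prod (isCompact_Icc (a := a) (b := b)))
    (by rintro ⟨p, q⟩ ⟨rfl, -⟩; rw [pi_mul_exp_re]; exact mul_pos Real.pi_pos hθ)
  have hκ : 0 < (Real.pi * Real.cos θ - |(w * exp (θ * I)).re|) / 2 := by
    have : |(w * exp (θ * I)).re| < Real.pi * Real.cos θ := hw
    linarith
  obtain ⟨B, hB, hB'⟩ := exists_zpow_bound hκ one_pos (max |a| |b|) j
  refine ⟨Real.exp (max |a| |b| * ‖w‖) * B * A, _, max T 1, hκ, le_max_right _ _, fun ε hε t ht => ?_⟩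
  have hε' : |ε| ≤ max |a| |b| := abs_le_max_abs_abs hε.1 hε.2
  exact norm_dilogKernel_le hB hε' le_rfl le_rfl (hA' (θ, ε) ⟨rfl, hε⟩ t ((le_max_left _ _).trans ht))
      (hB' θ ε t hε' ((le_max_right _ _).trans (ht.trans (abs_le_norm_rotatedLine _ _ _))))

lemma differentiableAt_dilogKernel {z : ℂ} (h0 : z ≠ 0) (h1 : sinh (Real.pi * z) ≠ 0) (j : ℤ)
    (w : ℂ) : DifferentiableAt ℂ (dilogKernel j w) z := by
  unfold dilogKernel
  exact DifferentiableAt.mul (DifferentiableAt.mul (by fun_prop)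
    (differentiableAt_zpow.2 (Or.inl h0))) (DifferentiableAt.inv (by fun_prop) h1)

lemma differentiableAt_dilogKernel_rotatedLine {θ ε : ℝ} (hε : 0 < ε) (hε' : ε < Real.cos θ) (j : ℤ)
    (w : ℂ) (t : ℝ) : DifferentiableAt ℂ (dilogKernel j w) (rotatedLine θ ε t) :=
  differentiableAt_dilogKernel (rotatedLine_ne_zero hε t)
    (sinh_pi_mul_rotatedLine_ne_zero hε hε' t) j w

lemma continuous_dilogKernel {θ ε : ℝ} (hε : 0 < ε) (hε' : ε < Real.cos θ) (j : ℤ) (w : ℂ) :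
    Continuous fun t => dilogKernel j w (rotatedLine θ ε t) :=
  continuous_iff_continuousAt.2 fun t =>
    (differentiableAt_dilogKernel_rotatedLine hε hε' j w t).continuousAt.comp
      (continuous_rotatedLine_apply θ ε).continuousAt

lemma integrable_dilogKernel {θ ε : ℝ} (hε : 0 < ε) (hε' : ε < Real.cos θ) (j : ℤ) {w : ℂ}
    (hw : w ∈ dilogStrip θ) : Integrable fun t => dilogKernel j w (rotatedLine θ ε t) := by
  obtain ⟨C, κ, hκ, hb⟩ := exists_dilogKernel_bound hε hε' hw ‖w‖ j
  exact integrable_of_exp_bound (T₀ := 0) hκ (continuous_dilogKernel hε hε' j w)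
    fun t _ => hb w le_rfl le_rfl t

lemma integrable_exp_neg_mul_abs {κ : ℝ} (hκ : 0 < κ) :
    Integrable fun t : ℝ => Real.exp (-κ * |t|) := by
  have := (integrable_of_exp_bound (h := fun t : ℝ => (Real.exp (-κ * |t|) : ℂ)) (C := 1) (T₀ := 0)
    hκ (by fun_prop) (fun t _ => by rw [norm_real, Real.norm_eq_abs, Real.abs_exp, one_mul])).re
  simpa only [RCLike.re_eq_complex_re, ofReal_re] using this

theorem hasDerivAt_dilogMoment {θ ε : ℝ} (hε : 0 < ε) (hε' : ε < Real.cos θ) (j : ℤ) {w : ℂ}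
    (hw : w ∈ dilogStrip θ) : HasDerivAt (dilogMoment θ ε j) (dilogMoment θ ε (j + 1) w) w := by
  have hw' : |(w * exp (θ * I)).re| < Real.pi * Real.cos θ := hw
  obtain ⟨ρ, hρ, hρ'⟩ := exists_between hw'
  obtain ⟨C, κ, hκ, hb⟩ := exists_dilogKernel_bound hε hε' hρ' (‖w‖ + 1) (j + 1)
  have hs : {v : ℂ | |(v * exp (θ * I)).re| < ρ ∧ ‖v‖ < ‖w‖ + 1} ∈ 𝓝 w := by
    refine IsOpen.mem_nhds ?_ ⟨hρ, by simp⟩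
    exact (isOpen_lt (f := fun v : ℂ => |(v * exp (θ * I)).re|) (by fun_prop)
      continuous_const).inter (isOpen_lt continuous_norm continuous_const)
  refine (hasDerivAt_integral_of_dominated_loc_of_deriv_le
    (F := fun v t => dilogKernel j v (rotatedLine θ ε t) * exp (θ * I))
    (F' := fun v t => dilogKernel (j + 1) v (rotatedLine θ ε t) * exp (θ * I))
    (bound := fun t => C * Real.exp (-κ * |t|)) hs ?_ ?_ ?_ ?_ ?_ ?_).2
  · exact Eventually.of_forall fun v =>
      ((continuous_dilogKernel hε hε' j v).mul continuous_const).aestronglyMeasurable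
  · exact (integrable_dilogKernel hε hε' j hw).mul_const _
  · exact ((continuous_dilogKernel hε hε' (j + 1) w).mul continuous_const).aestronglyMeasurable
  · refine Eventually.of_forall fun t v hv => ?_
    rw [norm_mul, norm_exp_ofReal_mul_I, mul_one]
    exact hb v hv.1.le hv.2.le t
  · exact (integrable_exp_neg_mul_abs hκ).const_mul C
  · refine Eventually.of_forall fun t v _ => ?_
    have h0 : rotatedLine θ ε t ≠ 0 := rotatedLine_ne_zero hε t
    have h1 : HasDerivAt (fun v : ℂ => exp (v * rotatedLine θ ε t))
        (exp (v * rotatedLine θ ε t) * rotatedLine θ ε t) v := by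
      simpa using ((hasDerivAt_id v).mul_const (rotatedLine θ ε t)).cexp
    have h2 := ((h1.mul_const (rotatedLine θ ε t ^ j)).mul_const
      (sinh (Real.pi * rotatedLine θ ε t))⁻¹).mul_const (exp (θ * I))
    refine h2.congr_deriv ?_
    rw [dilogKernel, zpow_add_one₀ h0]
    ring

lemma iteratedDeriv_dilogMoment {θ ε : ℝ} (hε : 0 < ε) (hε' : ε < Real.cos θ) (j : ℤ) (m : ℕ)
    {w : ℂ} (hw : w ∈ dilogStrip θ) :
    iteratedDeriv m (dilogMoment θ ε j) w = dilogMoment θ ε (j + m) w := by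
  induction m generalizing w with
  | zero => simp
  | succ m ih =>
    rw [iteratedDeriv_succ]
    have : iteratedDeriv m (dilogMoment θ ε j) =ᶠ[𝓝 w] dilogMoment θ ε (j + m) := by
      filter_upwards [(isOpen_dilogStrip θ).mem_nhds hw] with v hv using ih hv
    rw [this.deriv_eq, (hasDerivAt_dilogMoment hε hε' _ hw).deriv]
    push_cast
    rw [add_assoc]

/-! ### The integral of `e^{wz} / sinh (π z)` -/

lemma exp_mul_I_rotate (θ : ℝ) : exp (θ * I) * (Real.sin θ + Real.cos θ * I) = I := by
  have := Complex.cos_sq_add_sin_sq (θ : ℂ)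
  rw [exp_mul_I, ofReal_sin, ofReal_cos]
  linear_combination I * this + sin (θ : ℂ) * cos (θ : ℂ) * I_sq

/-- Translation by the half period `i` of `sinh (π z)` moves the line parallel to itself. -/
lemma rotatedLine_add_cos (θ ε t : ℝ) :
    rotatedLine θ (ε + Real.cos θ) t = rotatedLine θ ε (t - Real.sin θ) + I := by
  have := exp_mul_I_rotate θ
  simp only [rotatedLine]
  push_cast at this ⊢
  linear_combination this

lemma eq_mul_cos_of_rotatedLine_eq {θ ε t : ℝ} {k : ℤ} (h : rotatedLine θ ε t = k * I) :
    ε = k * Real.cos θ := by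
  have h1 := congrArg im (rotatedLine_mul_exp_neg θ ε t)
  rw [h] at h1
  have h2 : exp (-(θ * I)) = exp ((-θ : ℝ) * I) := by push_cast; ring_nf
  rw [h2, mul_assoc, ← ofReal_intCast, im_ofReal_mul, mul_comm I, mul_I_im, exp_ofReal_mul_I_re] at h1
  simpa using h1.symm

lemma sinh_pi_mul_eq_zero {z : ℂ} (h : sinh (Real.pi * z) = 0) : ∃ k : ℤ, z = k * I := by
  have h' : sin (Real.pi * z * I) = 0 := by rw [sin_mul_I, h, zero_mul]
  obtain ⟨k, hk⟩ := Complex.sin_eq_zero_iff.1 h'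
  have hπ : (Real.pi : ℂ) ≠ 0 := ofReal_ne_zero.2 Real.pi_ne_zero
  refine ⟨-k, ?_⟩
  have h2 : z * I = k := mul_left_cancel₀ hπ (by linear_combination hk)
  push_cast
  linear_combination (-I) * h2 + z * I_sq

lemma sinh_pi_mul_add_I (z : ℂ) : sinh (Real.pi * (z + I)) = -sinh (Real.pi * z) := by
  rw [mul_add, sinh_add_pi_mul_I]

/-- The quasi-periodicity of `e^{wz} / sinh (π z)` under `z ↦ z + i` gives a linear equation for
its integral. The pole at `z = i` is removed by subtracting `e^{iw} / sinh (π z)`. -/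
lemma one_add_mul_dilogMoment {θ ε : ℝ} (hε : 0 < ε) (hε' : ε < Real.cos θ) {w : ℂ}
    (hw : w ∈ dilogStrip θ) :
    (1 + exp (I * w)) * dilogMoment θ ε 0 w = 2 * exp (I * w) * dilogMoment θ ε 0 0 := by
  have hθ : 0 < Real.cos θ := hε.trans hε'
  let e : ℂ → ℂ := fun z => exp (w * z)
  let s : ℂ → ℂ := fun z => sinh (Real.pi * z)
  have hsI : s I = 0 := by
    simp only [s]
    rw [← zero_add I, sinh_pi_mul_add_I]; simp
  -- Off `i` this is `(e^{wz} - e^{iw}) / sinh (π z)`, since `s i = 0`; it is regular at `i`.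
  let f : ℂ → ℂ := fun z => dslope e I z / dslope s I z
  have hf : ∀ z, z ≠ I → f z = dilogKernel 0 w z - exp (I * w) * dilogKernel 0 0 z := fun z hz => by
    have hz' : z - I ≠ 0 := sub_ne_zero.2 hz
    simp only [f, dslope_of_ne _ hz, slope_def_field, hsI, sub_zero]
    rw [div_div_div_cancel_right₀ hz']
    simp only [e, s, dilogKernel, zpow_zero, mul_one, zero_mul, exp_zero, one_mul, mul_comm I w]
    ring
  -- The zero `ik` of `sinh (π z)` lies on the line at distance `k cos θ`, so only `k = 1` is met.
  have hne : ∀ x ∈ Icc ε (ε + Real.cos θ), ∀ t, rotatedLine θ x t ≠ I →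
      s (rotatedLine θ x t) ≠ 0 := fun x hx t hI h => by
    obtain ⟨k, hk⟩ := sinh_pi_mul_eq_zero h
    have hx' := eq_mul_cos_of_rotatedLine_eq hk
    have hk1 : k ≠ 1 := by rintro rfl; exact hI (by simpa using hk)
    have a1 : (0 : ℝ) < k := by
      by_contra hcon
      nlinarith [hx.1]
    have a2 : (k : ℝ) < 2 := by
      by_contra hcon
      nlinarith [hx.2]
    have a3 : (0 : ℤ) < k := by exact_mod_cast a1
    have a4 : k < (2 : ℤ) := by exact_mod_cast a2
    omega
  have hse : DifferentiableOn ℂ (dslope e I) univ :=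
    (differentiableOn_dslope univ_mem).2 (by simp only [e]; fun_prop)
  have hss : DifferentiableOn ℂ (dslope s I) univ :=
    (differentiableOn_dslope univ_mem).2 (by simp only [s]; fun_prop)
  have hds : deriv s I ≠ 0 := by
    have : HasDerivAt s (cosh (Real.pi * I) * Real.pi) I := by
      simpa using ((hasDerivAt_id I).const_mul (Real.pi : ℂ)).csinh
    rw [this.deriv, cosh_mul_I, Complex.cos_pi]
    simp [Real.pi_ne_zero]
  have hd : ∀ x ∈ Icc ε (ε + Real.cos θ), ∀ t, DifferentiableAt ℂ f (rotatedLine θ x t) :=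
    fun x hx t => by
      refine ((hse _ (mem_univ _)).differentiableAt univ_mem).div
        ((hss _ (mem_univ _)).differentiableAt univ_mem) ?_
      by_cases h : rotatedLine θ x t = I
      · rw [h, dslope_same]; exact hds
      · rw [dslope_of_ne _ h, slope_def_field, hsI, sub_zero]
        exact div_ne_zero (hne x hx t h) (sub_ne_zero.2 h)
  obtain ⟨C₁, κ₁, T₁, hκ₁, hT₁, hb₁⟩ :=
    exists_dilogKernel_bound_far (a := ε) (b := ε + Real.cos θ) hθ hw 0
  obtain ⟨C₂, κ₂, T₂, hκ₂, hT₂, hb₂⟩ :=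
    exists_dilogKernel_bound_far (a := ε) (b := ε + Real.cos θ) hθ (zero_mem_dilogStrip hθ) 0
  have hlineI : ∀ x t, 1 < |t| → rotatedLine θ x t ≠ I := fun x t ht h => by
    have := abs_le_norm_rotatedLine θ x t
    rw [h, norm_I] at this
    linarith
  have key := integral_rotatedLine_shift (f := f) (θ := θ) (a := ε) (b := ε + Real.cos θ)
    (κ := min κ₁ κ₂) (C := |C₁| + ‖exp (I * w)‖ * |C₂|) (T₀ := max (max T₁ T₂) 2) (by linarith)
    (lt_min hκ₁ hκ₂) countable_empty (fun x hx t => (hd x hx t).continuousAt)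
    (fun x hx t _ => hd x hx t) (fun x hx t ht => by
      have t1 : T₁ ≤ |t| := ((le_max_left _ _).trans (le_max_left _ _)).trans ht
      have t2 : T₂ ≤ |t| := ((le_max_right _ _).trans (le_max_left _ _)).trans ht
      have t3 : 1 < |t| := one_lt_two.trans_le ((le_max_right _ _).trans ht)
      rw [hf _ (hlineI x t t3), add_mul, mul_assoc]
      refine (norm_sub_le _ _).trans ?_
      rw [norm_mul]
      gcongr
      · refine (hb₁ x hx t t1).trans ?_
        gcongr
        · exact le_abs_self _
        · exact min_le_left _ _
      · refine (hb₂ x hx t t2).trans ?_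
        gcongr
        · exact le_abs_self _
        · exact min_le_right _ _)
  -- On the upper line the integrand is expressed through its values on the lower one.
  have hup : ∀ t, f (rotatedLine θ (ε + Real.cos θ) t) =
      (fun t => exp (I * w) * dilogKernel 0 0 (rotatedLine θ ε t) -
        exp (I * w) * dilogKernel 0 w (rotatedLine θ ε t)) (t - Real.sin θ) := fun t => by
    have h0 : rotatedLine θ ε (t - Real.sin θ) + I ≠ I := by
      simpa using rotatedLine_ne_zero hε _
    rw [rotatedLine_add_cos, hf _ h0]
    simp only [dilogKernel, sinh_pi_mul_add_I, zpow_zero, mul_one, zero_mul, exp_zero, one_mul,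
      inv_neg, mul_comm I w, mul_add w, exp_add]
    ring
  have hlow : ∀ t, f (rotatedLine θ ε t) = dilogKernel 0 w (rotatedLine θ ε t) -
      exp (I * w) * dilogKernel 0 0 (rotatedLine θ ε t) := fun t => hf _ fun h => by
    have := eq_mul_cos_of_rotatedLine_eq (k := 1) (by simpa using h)
    rw [Int.cast_one, one_mul] at this
    exact hε'.ne this
  have i1 := integrable_dilogKernel hε hε' 0 hw
  have i2 := integrable_dilogKernel hε hε' 0 (zero_mem_dilogStrip hθ)
  simp only [hup, hlow] at key
  rw [integral_sub_right_eq_self (fun t => exp (I * w) * dilogKernel 0 0 (rotatedLine θ ε t) -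
      exp (I * w) * dilogKernel 0 w (rotatedLine θ ε t)),
    integral_sub i1 (i2.const_mul _), integral_sub (i2.const_mul _) (i1.const_mul _),
    integral_const_mul, integral_const_mul] at key
  simp only [dilogMoment, integral_mul_const]
  linear_combination exp (θ * I) * key

lemma tendsto_sinh_atTop : Tendsto Real.sinh atTop atTop := Real.sinhOrderIso.tendsto_atTop

lemma tendsto_sinh_atBot : Tendsto Real.sinh atBot atBot := Real.sinhOrderIso.tendsto_atBot

/-- For the horizontal line through `i / 2` the integral of `1 / sinh (π z)` is `-i` times the
integral of `1 / cosh (π t)`. -/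
lemma dilogMoment_horizontal : dilogMoment 0 (1 / 2) 0 0 = -I := by
  have hint := integrable_dilogKernel (θ := 0) (ε := 1 / 2) (by norm_num)
    (by rw [Real.cos_zero]; norm_num) 0 (zero_mem_dilogStrip (by simp))
  have hk : ∀ t, dilogKernel 0 0 (rotatedLine 0 (1 / 2) t) =
      ((Real.cosh (Real.pi * t))⁻¹ : ℝ) * (-I) := fun t => by
    have : (Real.pi : ℂ) * rotatedLine 0 (1 / 2) t = Real.pi * t + (Real.pi / 2 : ℂ) * I := by
      simp [rotatedLine]; ring
    rw [dilogKernel, this, sinh_add, cosh_mul_I, sinh_mul_I, Complex.cos_pi_div_two,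
      Complex.sin_pi_div_two]
    simp [mul_comm]
  have hd : ∀ t : ℝ, HasDerivAt
      (fun t : ℝ => ((Real.arctan (Real.sinh (Real.pi * t)) / Real.pi : ℝ) : ℂ) * (-I))
      (dilogKernel 0 0 (rotatedLine 0 (1 / 2) t)) t := fun t => by
    rw [hk]
    have h1 : HasDerivAt (fun t : ℝ => Real.arctan (Real.sinh (Real.pi * t)) / Real.pi)
        (Real.cosh (Real.pi * t))⁻¹ t := by
      have := ((((hasDerivAt_id t).const_mul Real.pi).sinh).arctan).div_const Real.pi
      refine this.congr_deriv ?_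
      have h2 := Real.cosh_sq (Real.pi * t)
      have h3 := Real.cosh_pos (Real.pi * t)
      simp only [id_eq, mul_one]
      rw [add_comm, ← h2]
      field_simp
    exact (h1.ofReal_comp).mul_const _
  have hlim : ∀ {l : Filter ℝ} {x : ℝ},
      Tendsto (fun t : ℝ => Real.arctan (Real.sinh (Real.pi * t))) l (𝓝 x) →
      Tendsto (fun t : ℝ => ((Real.arctan (Real.sinh (Real.pi * t)) / Real.pi : ℝ) : ℂ) * (-I)) l
        (𝓝 (((x / Real.pi : ℝ) : ℂ) * (-I))) := fun h =>
    ((continuous_ofReal.tendsto _).comp (h.div_const _)).mul_const _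
  have := integral_of_hasDerivAt_of_tendsto hd hint
    (hlim ((tendsto_nhds_of_tendsto_nhdsWithin Real.tendsto_arctan_atBot).comp
      (tendsto_sinh_atBot.comp (tendsto_id.const_mul_atBot Real.pi_pos))))
    (hlim ((tendsto_nhds_of_tendsto_nhdsWithin Real.tendsto_arctan_atTop).comp
      (tendsto_sinh_atTop.comp (tendsto_id.const_mul_atTop Real.pi_pos))))
  rw [dilogMoment, integral_mul_const, this]
  have hπ : (Real.pi : ℂ) ≠ 0 := ofReal_ne_zero.2 Real.pi_ne_zero
  push_cast
  simp
  field_simp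
  ring

lemma dilogKernel_zero_zero (z : ℂ) : dilogKernel 0 0 z = (sinh (Real.pi * z))⁻¹ := by
  simp [dilogKernel]

lemma exists_dilogKernel_zero_bound {K : Set (ℝ × ℝ)} (hK : IsCompact K)
    (h : ∀ p ∈ K, 0 < p.2 ∧ p.2 < Real.cos p.1) :
    ∃ C κ : ℝ, 0 < κ ∧ ∀ p ∈ K, ∀ t : ℝ,
      ‖dilogKernel 0 0 (rotatedLine p.1 p.2 t)‖ ≤ C * Real.exp (-κ * |t|) := by
  have hpos : ∀ p ∈ K, 0 < ((Real.pi : ℂ) * exp (p.1 * I)).re := fun p hp => by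
    rw [pi_mul_exp_re]; exact mul_pos Real.pi_pos ((h p hp).1.trans (h p hp).2)
  obtain ⟨C, hC, hb⟩ := exists_csch_bound Real.pi hK hpos
    fun p hp => sinh_pi_mul_rotatedLine_ne_zero (h p hp).1 (h p hp).2
  obtain ⟨κ, hκ, hκ'⟩ := hK.exists_forall_le'
    (f := fun p : ℝ × ℝ => ((Real.pi : ℂ) * exp (p.1 * I)).re) (by fun_prop) hpos
  refine ⟨C, κ, hκ, fun p hp t => ?_⟩
  rw [dilogKernel_zero_zero, neg_mul]
  refine (hb p hp t).trans ?_
  gcongr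
  exact hκ' p hp

lemma dilogMoment_zero_rotate {φ₀ φ₁ ε : ℝ} (h01 : φ₀ ≤ φ₁) (hπ : φ₁ - φ₀ < Real.pi) (hε : 0 < ε)
    (h0 : ε < Real.cos φ₀) (h1 : ε < Real.cos φ₁) :
    dilogMoment φ₀ ε 0 0 = dilogMoment φ₁ ε 0 0 := by
  have hcos : ∀ x : ℝ, Real.cos x = ((1 : ℂ) * exp (x * I)).re := fun x => by
    rw [one_mul, exp_ofReal_mul_I_re]
  have h : ∀ φ ∈ Icc φ₀ φ₁, ε < Real.cos φ := fun φ hφ => by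
    rw [hcos] at h0 h1 ⊢
    exact lt_re_mul_exp hε.le hπ hφ h0 h1
  obtain ⟨C, κ, hκ, hb⟩ := exists_dilogKernel_zero_bound
    ((isCompact_Icc (a := φ₀) (b := φ₁)).prod (isCompact_singleton (x := ε)))
    (by rintro ⟨a, b⟩ ⟨ha, rfl⟩; exact ⟨hε, h a ha⟩)
  exact integral_rotatedLine_rotate (T₀ := 0) h01 hκ
    (fun x hx t => differentiableAt_dilogKernel_rotatedLine hε (h x hx) 0 0 t)
    (fun x hx t _ => hb (x, _) ⟨hx, rfl⟩ t)

lemma dilogMoment_zero_shift {θ a b : ℝ} (hab : a ≤ b) (ha : 0 < a) (hb : b < Real.cos θ) :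
    dilogMoment θ a 0 0 = dilogMoment θ b 0 0 := by
  have h : ∀ x ∈ Icc a b, 0 < x ∧ x < Real.cos θ := fun x hx =>
    ⟨ha.trans_le hx.1, hx.2.trans_lt hb⟩
  obtain ⟨C, κ, hκ, hbd⟩ := exists_dilogKernel_zero_bound
    ((isCompact_singleton (x := θ)).prod (isCompact_Icc (a := a) (b := b)))
    (by rintro ⟨p, q⟩ ⟨rfl, hq⟩; exact h q hq)
  have := integral_rotatedLine_shift (f := dilogKernel 0 0) (θ := θ) (T₀ := 0) hab hκ
    countable_empty
    (fun x hx t => (differentiableAt_dilogKernel_rotatedLine (h x hx).1 (h x hx).2 0 0 t).continuousAt)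
    (fun x hx t _ => differentiableAt_dilogKernel_rotatedLine (h x hx).1 (h x hx).2 0 0 t)
    (fun x hx t _ => hbd (θ, x) ⟨rfl, hx⟩ t)
  rw [dilogMoment, dilogMoment, integral_mul_const, integral_mul_const, this]

lemma dilogMoment_zero_zero {θ ε : ℝ} (hθ : θ ∈ Ioo (-(Real.pi / 2)) (Real.pi / 2)) (hε : 0 < ε)
    (hε' : ε < Real.cos θ) : dilogMoment θ ε 0 0 = -I := by
  have h1 : ε < Real.cos 0 := by rw [Real.cos_zero]; exact hε'.trans_le (Real.cos_le_one θ)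
  have e1 : dilogMoment θ ε 0 0 = dilogMoment 0 ε 0 0 := by
    rcases le_total θ 0 with h | h
    · exact dilogMoment_zero_rotate h (by linarith [hθ.1, Real.pi_pos]) hε hε' h1
    · exact (dilogMoment_zero_rotate h (by linarith [hθ.2, Real.pi_pos]) hε h1 hε').symm
  rw [e1, ← dilogMoment_horizontal]
  rcases le_total ε (1 / 2) with h | h
  · exact dilogMoment_zero_shift h hε (by rw [Real.cos_zero]; norm_num)
  · exact (dilogMoment_zero_shift h (by norm_num) h1).symm

lemma one_add_exp_mul_dilogMoment {θ ε : ℝ} (hθ : θ ∈ Ioo (-(Real.pi / 2)) (Real.pi / 2))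
    (hε : 0 < ε) (hε' : ε < Real.cos θ) {w : ℂ} (hw : w ∈ dilogStrip θ) :
    (1 + exp (I * w)) * dilogMoment θ ε 0 w = -(2 * I * exp (I * w)) := by
  rw [one_add_mul_dilogMoment hε hε' hw, dilogMoment_zero_zero hθ hε hε']
  ring

/-! ### Alternating zeta values and the expansion of the hyperbolic cosecant -/

/-- An alternating sum is twice the sum over the even indices minus the full sum. -/
lemma HasSum.neg_one_pow_mul {a : ℕ → ℂ} {A B : ℂ} (ha : HasSum a A)
    (hb : HasSum (fun k => a (2 * k)) B) : HasSum (fun k => (-1) ^ k * a k) (2 * B - A) := by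
  have he : HasSum (fun k => if Even k then a k else 0) B := by
    have hinj : Function.Injective (fun k : ℕ => 2 * k) := fun x y h => by
      simpa using h
    refine (hinj.hasSum_iff ?_).1 ?_
    · intro k hk
      rw [if_neg]
      rintro ⟨r, rfl⟩
      exact hk ⟨r, by simp only; ring⟩
    · simpa [Function.comp_def] using hb
  have hsub := (he.mul_left 2).sub ha
  have heq : (fun k => 2 * (if Even k then a k else 0) - a k) = fun k => (-1) ^ k * a k := by
    funext k
    by_cases h : Even k
    · rw [if_pos h, h.neg_one_pow]; ring
    · rw [if_neg h, (Nat.not_even_iff_odd.1 h).neg_one_pow]; ring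
  rwa [heq] at hsub

/-- The coefficient of `x ^ (2m - 1)` in the Laurent expansion of `1 / sinh x`. -/
noncomputable def cschCoeff (m : ℕ) : ℂ :=
  2 * (1 - (2 : ℂ) ^ (2 * (m : ℤ) - 1)) * ((bernoulli (2 * m) : ℚ) : ℂ) / ((2 * m).factorial : ℂ)

lemma cschCoeff_zero : cschCoeff 0 = 1 := by
  simp [cschCoeff]
  norm_num

lemma cschCoeff_one : cschCoeff 1 = -1 / 6 := by
  simp [cschCoeff, bernoulli_two]
  norm_num

/-- The term `k = 0` vanishes, as division by zero gives zero. -/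
lemma hasSum_alternating_zeta {m : ℕ} (hm : m ≠ 0) :
    HasSum (fun k : ℕ => (-1 : ℂ) ^ k * (1 / ((Real.pi : ℂ) * k) ^ (2 * m)))
      ((-1) ^ (m + 1) * cschCoeff m / 2) := by
  have hπ : (Real.pi : ℂ) ≠ 0 := ofReal_ne_zero.2 Real.pi_ne_zero
  have h1 := (hasSum_ofReal.2 (hasSum_zeta_nat hm)).mul_left (1 / (Real.pi : ℂ) ^ (2 * m))
  have h2 : HasSum (fun k : ℕ => 1 / ((Real.pi : ℂ) * k) ^ (2 * m))
      ((-1) ^ (m + 1) * 2 ^ (2 * m - 1) * ((bernoulli (2 * m) : ℚ) : ℂ) / ((2 * m).factorial : ℂ)) := by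
    convert! h1 using 1
    · funext k
      push_cast
      rw [mul_pow, one_div_mul_one_div]
    · push_cast
      field_simp
  have h3 : HasSum (fun k : ℕ => 1 / ((Real.pi : ℂ) * (2 * k : ℕ)) ^ (2 * m))
      (1 / 2 ^ (2 * m) * ((-1) ^ (m + 1) * 2 ^ (2 * m - 1) * ((bernoulli (2 * m) : ℚ) : ℂ) /
        ((2 * m).factorial : ℂ))) := by
    convert! h2.mul_left (1 / 2 ^ (2 * m)) using 1
    funext k
    push_cast
    rw [one_div_mul_one_div, ← mul_pow]
    ring
  have h4 := h2.neg_one_pow_mul h3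
  convert! h4 using 1
  obtain ⟨n, rfl⟩ := Nat.exists_eq_succ_of_ne_zero hm
  have e1 : 2 * (n + 1) - 1 = 2 * n + 1 := by omega
  have e2 : (2 * ((n + 1 : ℕ) : ℤ) - 1) = ((2 * n + 1 : ℕ) : ℤ) := by push_cast; ring
  have h2' : (2 : ℂ) ≠ 0 := two_ne_zero
  have hf : ((2 * (n + 1)).factorial : ℂ) ≠ 0 := by exact_mod_cast (Nat.factorial_ne_zero _)
  rw [cschCoeff, Nat.succ_eq_add_one, e1, e2, zpow_natCast,
    show (2 : ℂ) ^ (2 * (n + 1)) = 2 * 2 ^ (2 * n + 1) by ring]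
  field_simp

/-- The partial fraction expansion of `coth u`. The term `k = 0` is `2 / u`. -/
lemma hasSum_coth {u : ℂ} (hu : sinh u ≠ 0) :
    HasSum (fun k : ℕ => 2 * u / (u ^ 2 + ((Real.pi : ℂ) * k) ^ 2)) (cosh u / sinh u + 1 / u) := by
  have hπ : (Real.pi : ℂ) ≠ 0 := ofReal_ne_zero.2 Real.pi_ne_zero
  have hu0 : u ≠ 0 := by rintro rfl; simp at hu
  have hx : (u * I / Real.pi) ∈ integerComplement := by
    rintro ⟨k, hk⟩
    have : u * I = k * Real.pi := by
      rw [eq_div_iff hπ] at hk; exact hk.symm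
    apply hu
    have h2 : sin (u * I) = 0 := by rw [this]; exact Complex.sin_int_mul_pi k
    rw [sin_mul_I] at h2
    simpa using h2
  have hden : ∀ k : ℕ, u ^ 2 + ((Real.pi : ℂ) * (k + 1)) ^ 2 ≠ 0 := fun k h => by
    have h1 : (u * I / Real.pi + (k + 1)) * (u * I / Real.pi - (k + 1)) = 0 := by
      have : (u * I / Real.pi + (k + 1)) * (u * I / Real.pi - (k + 1)) =
          -(u ^ 2 + ((Real.pi : ℂ) * (k + 1)) ^ 2) / (Real.pi : ℂ) ^ 2 := by
        field_simp
        rw [← sub_eq_zero]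
        ring_nf
        simp
      rw [this, h]; simp
    rcases mul_eq_zero.1 h1 with h | h
    · exact hx ⟨-(k + 1), by push_cast; linear_combination -h⟩
    · exact hx ⟨k + 1, by push_cast; linear_combination -h⟩
  have hs := (summable_cotTerm hx).hasSum
  have hval := cot_series_rep' hx
  rw [← hval] at hs
  have hs' := hs.mul_left (I / Real.pi)
  rw [← hasSum_nat_add_iff' 1]
  convert! hs' using 1
  · funext k
    rw [cotTerm_identity hx k]
    have hne : (u * I / Real.pi + (k + 1)) * (u * I / Real.pi - (k + 1)) =
          -(u ^ 2 + ((Real.pi : ℂ) * (k + 1)) ^ 2) / (Real.pi : ℂ) ^ 2 := by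
        field_simp
        rw [← sub_eq_zero]
        ring_nf
        simp
    rw [hne]
    have := hden k
    push_cast
    field_simp
    rw [I_sq]
    ring
  · rw [mul_div_cancel₀ _ hπ, cot_eq_cos_div_sin, cos_mul_I, sin_mul_I]
    simp only [Finset.range_one, Finset.sum_singleton, Nat.cast_zero, mul_zero]
    field_simp
    ring_nf

/-- The partial fraction expansion of `1 / sinh u`. The term `k = 0` is `2 / u`. -/
lemma hasSum_csch {u : ℂ} (hu : sinh u ≠ 0) :
    HasSum (fun k : ℕ => (-1) ^ k * (2 * u / (u ^ 2 + ((Real.pi : ℂ) * k) ^ 2)))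
      (1 / sinh u + 1 / u) := by
  have hu0 : u ≠ 0 := by rintro rfl; simp at hu
  have h2 : sinh u = 2 * sinh (u / 2) * cosh (u / 2) := by
    rw [← sinh_two_mul]; congr 1; ring
  have h3 : cosh u = cosh (u / 2) ^ 2 + sinh (u / 2) ^ 2 := by
    rw [← cosh_two_mul]; congr 1; ring
  have h4 := cosh_sq_sub_sinh_sq (u / 2)
  have hs : sinh (u / 2) ≠ 0 := fun h => hu (by rw [h2, h]; simp)
  have hc : cosh (u / 2) ≠ 0 := fun h => hu (by rw [h2, h]; simp)
  have hb := (hasSum_coth hs).mul_left (1 / 2)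
  have hb' : HasSum (fun k : ℕ => 2 * u / (u ^ 2 + ((Real.pi : ℂ) * (2 * k : ℕ)) ^ 2))
      (1 / 2 * (cosh (u / 2) / sinh (u / 2) + 1 / (u / 2))) := by
    convert! hb using 1
    funext k
    have : (u / 2) ^ 2 + ((Real.pi : ℂ) * k) ^ 2 =
        (u ^ 2 + ((Real.pi : ℂ) * (2 * k : ℕ)) ^ 2) / 4 := by push_cast; ring
    rw [this, div_div_eq_mul_div]
    ring
  have := (hasSum_coth hu).neg_one_pow_mul hb'
  convert! this using 1
  rw [h2, h3]
  field_simp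
  linear_combination (-u) * h4

/-- The remainder of the Laurent expansion of `1 / sinh u` after the term `u ^ (2n - 1)`. -/
noncomputable def cschRem (n : ℕ) (u : ℂ) : ℂ :=
  1 / sinh u - ∑ m ∈ Finset.range (n + 1), cschCoeff m * u ^ (2 * (m : ℤ) - 1)

lemma sq_add_sq_ne_zero_of_sinh_ne_zero {u : ℂ} (hu : sinh u ≠ 0) (k : ℕ) :
    u ^ 2 + ((Real.pi : ℂ) * k) ^ 2 ≠ 0 := by
  intro h
  have h1 : (u * I - k * Real.pi) * (u * I + k * Real.pi) = 0 := by
    linear_combination u ^ 2 * I_sq - h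
  have h2 : sin (u * I) = 0 := by
    rcases mul_eq_zero.1 h1 with h | h
    · rw [sub_eq_zero.1 h]; exact Complex.sin_nat_mul_pi k
    · rw [eq_neg_of_add_eq_zero_left h, Complex.sin_neg, Complex.sin_nat_mul_pi, neg_zero]
  rw [sin_mul_I] at h2
  exact hu (by simpa using h2)

/-- The remainder as a series of partial fractions. The term `k = 0` vanishes, as division by zero
gives zero. -/
lemma hasSum_cschRem {n : ℕ} (hn : 1 ≤ n) {u : ℂ} (hu : sinh u ≠ 0) :
    HasSum (fun k : ℕ => (-1) ^ k * ((-1) ^ n * (2 * u ^ (2 * n + 1)) /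
      (((Real.pi : ℂ) * k) ^ (2 * n) * (u ^ 2 + ((Real.pi : ℂ) * k) ^ 2)))) (cschRem n u) := by
  have hu0 : u ≠ 0 := by rintro rfl; simp at hu
  have hπ : (Real.pi : ℂ) ≠ 0 := ofReal_ne_zero.2 Real.pi_ne_zero
  induction n, hn using Nat.le_induction with
  | base =>
    have h0 : HasSum (fun k : ℕ => if k = 0 then 2 / u else 0) (2 / u) := hasSum_ite_eq 0 _
    have h1 := (hasSum_alternating_zeta one_ne_zero).mul_left (2 * u)
    convert! ((hasSum_csch hu).sub h0).sub h1 using 1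
    · funext k
      rcases Nat.eq_zero_or_pos k with rfl | hk
      · simp
        field_simp
        simp
      · have hk' : (k : ℂ) ≠ 0 := by exact_mod_cast hk.ne'
        have := sq_add_sq_ne_zero_of_sinh_ne_zero hu k
        have ha : (Real.pi : ℂ) * k ≠ 0 := mul_ne_zero hπ hk'
        rw [if_neg hk.ne']
        generalize (Real.pi : ℂ) * k = a at *
        field_simp
        ring
    · rw [cschRem, Finset.sum_range_succ, Finset.sum_range_one, cschCoeff_zero]
      simp
      field_simp
      ring
  | succ n hn ih =>
    have h1 := (hasSum_alternating_zeta (m := n + 1) (by omega)).mul_left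
      ((-1) ^ n * (2 * u ^ (2 * n + 1)))
    convert! ih.sub h1 using 1
    · funext k
      rcases Nat.eq_zero_or_pos k with rfl | hk
      · have : n ≠ 0 := by omega
        simp [this]
      · have hk' : (k : ℂ) ≠ 0 := by exact_mod_cast hk.ne'
        have := sq_add_sq_ne_zero_of_sinh_ne_zero hu k
        have ha : (Real.pi : ℂ) * k ≠ 0 := mul_ne_zero hπ hk'
        generalize (Real.pi : ℂ) * k = a at *
        rw [show 2 * (n + 1) = 2 * n + 2 by ring]
        field_simp
        ring
    · rw [cschRem, Finset.sum_range_succ, ← sub_sub]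
      have e : 2 * ((n + 1 : ℕ) : ℤ) - 1 = ((2 * n + 1 : ℕ) : ℤ) := by push_cast; ring
      have hsq : ((-1 : ℂ) ^ n) * (-1) ^ (n + 1 + 1) = 1 := by
        rw [← pow_add, show n + (n + 1 + 1) = 2 * (n + 1) by ring, pow_mul]; simp
      rw [e, zpow_natCast, cschRem]
      linear_combination cschCoeff (n + 1) * u ^ (2 * n + 1) * hsq

/-- On a ray the poles `±ia` stay away from `u`: the distance is controlled by `Re u`. -/
lemma two_mul_abs_re_le_norm_sq_add (u : ℂ) {a : ℝ} (ha : 0 ≤ a) :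
    2 * a * |u.re| ≤ ‖u ^ 2 + (a : ℂ) ^ 2‖ := by
  rw [← abs_of_nonneg (by positivity : 0 ≤ 2 * a * |u.re|), ← abs_norm, ← sq_le_sq, mul_pow, sq_abs,
    ← normSq_eq_norm_sq, normSq_apply]
  simp only [pow_two, add_re, add_im, mul_re, mul_im, ofReal_re, ofReal_im]
  nlinarith [sq_nonneg (u.re * u.re + u.im * u.im - a * a)]

lemma norm_cschRem_le {n : ℕ} (hn : 1 ≤ n) {u : ℂ} (hu : u.re ≠ 0) :
    ‖cschRem n u‖ ≤ ‖u‖ ^ (2 * n + 1) / |u.re| * (1 / (6 * Real.pi ^ (2 * n - 1))) := by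
  have hπ := Real.pi_pos
  have hs := sinh_ne_zero_of_re_ne_zero hu
  have h1 := (hasSum_zeta_two.mul_left (‖u‖ ^ (2 * n + 1) / |u.re| * (1 / Real.pi ^ (2 * n + 1))))
  have e : 2 * n + 1 = (2 * n - 1) + 2 := by omega
  refine ((hasSum_cschRem hn hs).norm_le_of_bounded h1 fun k => ?_).trans (le_of_eq ?_)
  · rcases Nat.eq_zero_or_pos k with rfl | hk
    · have : n ≠ 0 := by omega
      simp [this]
    · have hk' : (1 : ℝ) ≤ k := by exact_mod_cast hk
      have hu' : 0 < |u.re| := abs_pos.2 hu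
      have h2 := two_mul_abs_re_le_norm_sq_add u (a := Real.pi * k) (by positivity)
      push_cast at h2
      rw [norm_mul, norm_pow, norm_neg, norm_one, one_pow, one_mul, norm_div, norm_mul, norm_pow,
        norm_neg, norm_one, one_pow, one_mul, norm_mul, norm_mul, norm_pow, norm_pow, norm_mul,
        norm_real, Real.norm_of_nonneg hπ.le, Complex.norm_natCast, Complex.norm_ofNat]
      calc _ ≤ 2 * ‖u‖ ^ (2 * n + 1) / ((Real.pi * k) ^ (2 * n) * (2 * (Real.pi * k) * |u.re|)) := by
            gcongr
        _ = ‖u‖ ^ (2 * n + 1) / |u.re| * (1 / Real.pi ^ (2 * n + 1)) * (1 / (k : ℝ) ^ (2 * n + 1)) := by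
            rw [mul_pow, pow_succ Real.pi, pow_succ (k : ℝ)]
            field_simp
        _ ≤ _ := by
            gcongr
            omega
  · rw [show Real.pi ^ (2 * n + 1) = Real.pi ^ (2 * n - 1) * Real.pi ^ 2 by rw [← pow_add, ← e]]
    field_simp

/-- The remainder vanishes at the origin to order `2n + 1`. -/
lemma exists_norm_cschRem_le {n : ℕ} (hn : 1 ≤ n) :
    ∃ C : ℝ, ∀ u : ℂ, ‖u‖ ≤ 1 → sinh u ≠ 0 → ‖cschRem n u‖ ≤ C * ‖u‖ ^ (2 * n + 1) := by
  have hπ := Real.pi_pos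
  refine ⟨2 * (Real.pi ^ 2 / 6), fun u hu hs => ?_⟩
  have h1 := (hasSum_zeta_two.mul_left (2 * ‖u‖ ^ (2 * n + 1)))
  refine ((hasSum_cschRem hn hs).norm_le_of_bounded h1 fun k => ?_).trans (le_of_eq (by ring))
  rcases Nat.eq_zero_or_pos k with rfl | hk
  · have : n ≠ 0 := by omega
    simp [this]
  · have hk' : (1 : ℝ) ≤ k := by exact_mod_cast hk
    have hp : (3 : ℝ) < Real.pi := Real.pi_gt_three
    have hpk : (k : ℝ) ≤ Real.pi * k := by nlinarith
    have h2 : 1 ≤ ‖u ^ 2 + ((Real.pi : ℂ) * k) ^ 2‖ := by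
      have e1 := norm_sub_norm_le (((Real.pi : ℂ) * k) ^ 2) (-u ^ 2)
      rw [sub_neg_eq_add, norm_neg, norm_pow, norm_pow, norm_mul, norm_real,
        Real.norm_of_nonneg hπ.le, Complex.norm_natCast, add_comm] at e1
      have e2 : ‖u‖ ^ 2 ≤ 1 := pow_le_one₀ (norm_nonneg _) hu
      have e3 : 3 ≤ Real.pi * k := by nlinarith
      nlinarith
    rw [norm_mul, norm_pow, norm_neg, norm_one, one_pow, one_mul, norm_div, norm_mul, norm_pow,
      norm_neg, norm_one, one_pow, one_mul, norm_mul, norm_mul, norm_pow, norm_pow, norm_mul,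
      norm_real, Real.norm_of_nonneg hπ.le, Complex.norm_natCast, Complex.norm_ofNat]
    have h3 : (k : ℝ) ^ 2 ≤ (Real.pi * k) ^ (2 * n) := by
      calc (k : ℝ) ^ 2 ≤ (Real.pi * k) ^ 2 := by gcongr
        _ ≤ _ := pow_le_pow_right₀ (by linarith) (by omega)
    rw [mul_one_div]
    gcongr
    nlinarith

/-! ### The dilogarithm as a contour integral -/

lemma hasDerivAt_liTwo {z : ℂ} (hz : ‖z‖ < 1) :
    HasDerivAt liTwo (∑' k : ℕ, z ^ k / ((k : ℂ) + 1)) z := by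
  obtain ⟨r, hr, hr1⟩ := exists_between hz
  have hr0 : 0 < r := (norm_nonneg z).trans_lt hr
  have hk : ∀ k : ℕ, (k : ℂ) + 1 ≠ 0 := fun k => Nat.cast_add_one_ne_zero k
  refine hasDerivAt_tsum_of_isPreconnected (t := Metric.ball (0 : ℂ) r) (y₀ := 0)
    (g := fun (k : ℕ) (z : ℂ) => z ^ (k + 1) / ((k : ℂ) + 1) ^ 2)
    (g' := fun (k : ℕ) (z : ℂ) => z ^ k / ((k : ℂ) + 1))
    (summable_geometric_of_lt_one hr0.le hr1) Metric.isOpen_ball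
    (convex_ball _ _).isPreconnected (fun k y _ => ?_) (fun k y hy => ?_) (by simpa) ?_ (by simpa)
  · refine ((hasDerivAt_pow (k + 1) y).div_const _).congr_deriv ?_
    have := hk k
    push_cast
    field_simp
  · have hy' : ‖y‖ ≤ r := by simpa using (mem_ball_zero_iff.1 hy).le
    rw [norm_div, norm_pow]
    have : (1 : ℝ) ≤ ‖(k : ℂ) + 1‖ := by
      rw [← Nat.cast_add_one, Complex.norm_natCast]; push_cast; linarith [k.cast_nonneg (α := ℝ)]
    exact (div_le_self (by positivity) this).trans (by gcongr)
  · simp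

lemma continuousOn_liTwo : ContinuousOn liTwo (Metric.closedBall 0 1) := by
  refine continuousOn_tsum (u := fun k : ℕ => 1 / ((k : ℝ) + 1) ^ 2) (fun k => by fun_prop) ?_ ?_
  · have := (summable_nat_add_iff 1).2 (Real.summable_one_div_nat_pow.2 one_lt_two)
    simpa using this
  · intro k z hz
    rw [norm_div, norm_pow, norm_pow, ← Nat.cast_add_one, Complex.norm_natCast]
    push_cast
    gcongr
    exact pow_le_one₀ (norm_nonneg _) (by simpa using hz)

lemma liTwo_zero : liTwo 0 = 0 := by simp [liTwo]

/-- This value fixes the constant in the reflection formula. -/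
lemma liTwo_neg_one : liTwo (-1) = -(Real.pi : ℂ) ^ 2 / 12 := by
  have hπ : (Real.pi : ℂ) ≠ 0 := ofReal_ne_zero.2 Real.pi_ne_zero
  have h := ((hasSum_nat_add_iff' 1).2 (hasSum_alternating_zeta one_ne_zero)).mul_left
    ((Real.pi : ℂ) ^ 2)
  have h2 : HasSum (fun k : ℕ => (-1 : ℂ) ^ (k + 1) / ((k : ℂ) + 1) ^ 2)
      (-(Real.pi : ℂ) ^ 2 / 12) := by
    convert! h using 1
    · funext k
      push_cast
      rw [mul_pow]
      field_simp
    · rw [cschCoeff_one]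
      simp
      ring
  exact h2.tsum_eq

lemma norm_neg_exp_I_mul (w : ℂ) : ‖-exp (I * w)‖ = Real.exp (-w.im) := by
  rw [norm_neg, norm_exp]; simp

lemma norm_neg_exp_I_mul_lt_one {w : ℂ} (hw : 0 < w.im) : ‖-exp (I * w)‖ < 1 := by
  rw [norm_neg_exp_I_mul, Real.exp_lt_one_iff]; linarith

lemma hasDerivAt_exp_I_mul (w : ℂ) : HasDerivAt (fun w => exp (I * w)) (I * exp (I * w)) w := by
  have := ((hasDerivAt_id w).const_mul I).cexp
  simpa [mul_comm] using this

lemma hasDerivAt_liTwo_neg_exp {w : ℂ} (hw : 0 < w.im) :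
    HasDerivAt (fun w => liTwo (-exp (I * w))) (-I * log (1 + exp (I * w))) w := by
  have hz := norm_neg_exp_I_mul_lt_one hw
  refine ((hasDerivAt_liTwo hz).comp w (hasDerivAt_exp_I_mul w).neg).congr_deriv ?_
  have h1 := (hasSum_taylorSeries_neg_log' hz).tsum_eq
  rw [sub_neg_eq_add] at h1
  have h2 : ∑' k : ℕ, (-exp (I * w)) ^ (k + 1) / ((k : ℂ) + 1) =
      (-exp (I * w)) * ∑' k : ℕ, (-exp (I * w)) ^ k / ((k : ℂ) + 1) := by
    rw [← tsum_mul_left]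
    congr 1
    funext k
    ring
  rw [h2] at h1
  linear_combination I * h1

lemma one_add_exp_mem_slitPlane {w : ℂ} (hw : 0 < w.im) : 1 + exp (I * w) ∈ slitPlane := by
  left
  have h1 := norm_neg_exp_I_mul_lt_one hw
  rw [norm_neg] at h1
  have h2 := (abs_le.1 (abs_re_le_norm (exp (I * w)))).1
  rw [add_re, one_re]
  linarith

lemma hasDerivAt_log_one_add_exp {w : ℂ} (hw : 0 < w.im) :
    HasDerivAt (fun w => log (1 + exp (I * w))) (I * exp (I * w) / (1 + exp (I * w))) w :=
  ((hasDerivAt_exp_I_mul w).const_add 1).clog (one_add_exp_mem_slitPlane hw)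

/-- The point `i y e^{-iθ}`, on the axis of the strip `dilogStrip θ`. -/
noncomputable def stripAxis (θ y : ℝ) : ℂ := y * I * exp (-(θ * I))

lemma stripAxis_mul_exp (θ y : ℝ) : stripAxis θ y * exp (θ * I) = y * I := by
  rw [stripAxis, mul_assoc, ← exp_add]; simp

lemma stripAxis_mem {θ : ℝ} (hθ : 0 < Real.cos θ) (y : ℝ) : stripAxis θ y ∈ dilogStrip θ := by
  rw [dilogStrip, mem_ofPred_eq, stripAxis_mul_exp]
  simpa using mul_pos Real.pi_pos hθ

lemma stripAxis_im (θ y : ℝ) : (stripAxis θ y).im = y * Real.cos θ := by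
  have h2 : exp (-(θ * I)) = exp ((-θ : ℝ) * I) := by push_cast; ring_nf
  rw [stripAxis, h2, mul_assoc, im_ofReal_mul, mul_comm I, mul_I_im, exp_ofReal_mul_I_re,
    Real.cos_neg]

lemma tendsto_dilogMoment_stripAxis {θ ε : ℝ} (hε : 0 < ε) (j : ℤ) :
    Tendsto (fun y : ℝ => dilogMoment θ ε j (stripAxis θ y)) atTop (𝓝 0) := by
  have hk : ∀ y t : ℝ, ‖dilogKernel j (stripAxis θ y) (rotatedLine θ ε t) * exp (θ * I)‖ =
      Real.exp (-(ε * y)) * ‖dilogKernel j 0 (rotatedLine θ ε t)‖ := fun y t => by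
    have : stripAxis θ y * rotatedLine θ ε t = y * I * (t + ε * I) := by
      rw [rotatedLine, ← mul_assoc, stripAxis_mul_exp]
    rw [norm_mul, norm_exp_ofReal_mul_I, mul_one, dilogKernel, dilogKernel, this, zero_mul, exp_zero,
      one_mul, mul_assoc, norm_mul, norm_exp]
    congr 2
    simp
    ring
  have h1 : Tendsto (fun y : ℝ => Real.exp (-(ε * y)) *
      ∫ t, ‖dilogKernel j 0 (rotatedLine θ ε t)‖) atTop (𝓝 0) := by
    have : Tendsto (fun y : ℝ => Real.exp (-(ε * y))) atTop (𝓝 0) :=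
      Real.tendsto_exp_neg_atTop_nhds_zero.comp (tendsto_id.const_mul_atTop hε)
    simpa using this.mul_const _
  refine squeeze_zero_norm (fun y => ?_) h1
  refine (norm_integral_le_integral_norm _).trans (le_of_eq ?_)
  simp only [hk, integral_const_mul]

lemma tendsto_exp_stripAxis {θ : ℝ} (hθ : 0 < Real.cos θ) :
    Tendsto (fun y : ℝ => exp (I * stripAxis θ y)) atTop (𝓝 0) := by
  rw [tendsto_zero_iff_norm_tendsto_zero]
  have : Tendsto (fun y : ℝ => Real.exp (-(y * Real.cos θ))) atTop (𝓝 0) :=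
    Real.tendsto_exp_neg_atTop_nhds_zero.comp (tendsto_id.atTop_mul_const hθ)
  refine this.congr fun y => ?_
  rw [← norm_neg, norm_neg_exp_I_mul, stripAxis_im]

/-- A function on the upper half of the strip with derivative zero that tends to zero along the
axis is zero. -/
lemma eq_zero_of_hasDerivAt_zero {θ : ℝ} (hθ : 0 < Real.cos θ) {D : ℂ → ℂ}
    (hD : ∀ w ∈ dilogStrip θ, 0 < w.im → HasDerivAt D 0 w)
    (hlim : Tendsto (fun y : ℝ => D (stripAxis θ y)) atTop (𝓝 0)) {w : ℂ} (hw : w ∈ dilogStrip θ)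
    (hw' : 0 < w.im) : D w = 0 := by
  have ho : IsOpen (dilogStrip θ ∩ {w | 0 < w.im}) :=
    (isOpen_dilogStrip θ).inter (isOpen_lt continuous_const continuous_im)
  have hc : IsPreconnected (dilogStrip θ ∩ {w | 0 < w.im}) :=
    ((convex_dilogStrip θ).inter (convex_halfSpace_im_gt 0)).isPreconnected
  refine tendsto_nhds_unique (Tendsto.congr' ?_ tendsto_const_nhds) hlim
  filter_upwards [eventually_gt_atTop 0] with y hy
  refine ho.is_const_of_deriv_eq_zero hc
    (fun v hv => (hD v hv.1 hv.2).differentiableAt.differentiableWithinAt)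
    (fun v hv => (hD v hv.1 hv.2).deriv) ⟨hw, hw'⟩ ⟨stripAxis_mem hθ y, ?_⟩
  rw [mem_ofPred_eq, stripAxis_im]
  exact mul_pos hy hθ

lemma dilogMoment_neg_one {θ ε : ℝ} (hθ : θ ∈ Ioo (-(Real.pi / 2)) (Real.pi / 2)) (hε : 0 < ε)
    (hε' : ε < Real.cos θ) {w : ℂ} (hw : w ∈ dilogStrip θ) (hw' : 0 < w.im) :
    dilogMoment θ ε (-1) w = -2 * log (1 + exp (I * w)) := by
  have hc : 0 < Real.cos θ := hε.trans hε'
  have := eq_zero_of_hasDerivAt_zero hc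
    (D := fun w => dilogMoment θ ε (-1) w + 2 * log (1 + exp (I * w))) (fun v hv hv' => ?_) ?_ hw hw'
  · linear_combination this
  · refine ((hasDerivAt_dilogMoment hε hε' (-1) hv).add
      ((hasDerivAt_log_one_add_exp hv').const_mul 2)).congr_deriv ?_
    have h1 := one_add_exp_mul_dilogMoment hθ hε hε' hv
    have h2 := slitPlane_ne_zero (one_add_exp_mem_slitPlane hv')
    rw [neg_add_cancel]
    field_simp
    linear_combination h1
  · have h1 : Tendsto (fun y : ℝ => 2 * log (1 + exp (I * stripAxis θ y))) atTop (𝓝 0) := by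
      have h2 : ContinuousAt (fun z : ℂ => 2 * log (1 + z)) 0 := by
        refine ContinuousAt.mul continuousAt_const (ContinuousAt.clog (by fun_prop) (by simp))
      have := h2.tendsto.comp (tendsto_exp_stripAxis hc)
      simpa [Function.comp_def] using this
    simpa using (tendsto_dilogMoment_stripAxis hε (-1)).add h1

lemma dilogMoment_neg_two_of_pos {θ ε : ℝ} (hθ : θ ∈ Ioo (-(Real.pi / 2)) (Real.pi / 2))
    (hε : 0 < ε) (hε' : ε < Real.cos θ) {w : ℂ} (hw : w ∈ dilogStrip θ) (hw' : 0 < w.im) :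
    dilogMoment θ ε (-2) w = -2 * I * liTwo (-exp (I * w)) := by
  have hc : 0 < Real.cos θ := hε.trans hε'
  have := eq_zero_of_hasDerivAt_zero hc
    (D := fun w => dilogMoment θ ε (-2) w + 2 * I * liTwo (-exp (I * w))) (fun v hv hv' => ?_) ?_
    hw hw'
  · linear_combination this
  · refine ((hasDerivAt_dilogMoment hε hε' (-2) hv).add
      ((hasDerivAt_liTwo_neg_exp hv').const_mul (2 * I))).congr_deriv ?_
    rw [show (-2 + 1 : ℤ) = -1 by norm_num, dilogMoment_neg_one hθ hε hε' hv hv']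
    linear_combination (-2) * log (1 + exp (I * v)) * I_sq
  · have h1 : Tendsto (fun y : ℝ => 2 * I * liTwo (-exp (I * stripAxis θ y))) atTop (𝓝 0) := by
      have h2 : ContinuousAt (fun z : ℂ => 2 * I * liTwo (-z)) 0 := by
        refine ContinuousAt.mul continuousAt_const ?_
        have h3 : ContinuousAt liTwo (-0) := (hasDerivAt_liTwo (by simp)).continuousAt
        exact h3.comp (f := fun z : ℂ => -z) continuousAt_neg
      have := h2.tendsto.comp (tendsto_exp_stripAxis hc)
      simpa [Function.comp_def, liTwo_zero] using this
    simpa using (tendsto_dilogMoment_stripAxis hε (-2)).add h1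

/-- The boundary of the half plane is reached by continuity from above. -/
lemma dilogMoment_neg_two_of_nonneg {θ ε : ℝ} (hθ : θ ∈ Ioo (-(Real.pi / 2)) (Real.pi / 2))
    (hε : 0 < ε) (hε' : ε < Real.cos θ) {w : ℂ} (hw : w ∈ dilogStrip θ) (hw' : 0 ≤ w.im) :
    dilogMoment θ ε (-2) w = -2 * I * liTwo (-exp (I * w)) := by
  have hpath : Tendsto (fun s : ℝ => w + s * I) (𝓝[>] 0) (𝓝 w) := by
    have : Continuous fun s : ℝ => w + s * I := by fun_prop
    simpa using (this.tendsto 0).mono_left nhdsWithin_le_nhds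
  have h1 := (hasDerivAt_dilogMoment hε hε' (-2) hw).continuousAt.tendsto.comp hpath
  have hball : ∀ v : ℂ, 0 ≤ v.im → -exp (I * v) ∈ Metric.closedBall (0 : ℂ) 1 := fun v hv => by
    rw [mem_closedBall_zero_iff, norm_neg_exp_I_mul, Real.exp_le_one_iff]; linarith
  have h2 : Tendsto (fun s : ℝ => -exp (I * (w + s * I))) (𝓝[>] 0)
      (𝓝[Metric.closedBall 0 1] (-exp (I * w))) := by
    refine tendsto_nhdsWithin_iff.2 ⟨?_, ?_⟩
    · have : Continuous fun v : ℂ => -exp (I * v) := by fun_prop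
      exact (this.tendsto w).comp hpath
    · filter_upwards [self_mem_nhdsWithin] with s hs
      refine hball _ ?_
      have : (0 : ℝ) < s := hs
      simp
      linarith
  have h3 := ((continuousOn_liTwo _ (hball w hw')).tendsto.comp h2).const_mul (-2 * I)
  refine tendsto_nhds_unique h1 (h3.congr' ?_)
  filter_upwards [self_mem_nhdsWithin, hpath.eventually ((isOpen_dilogStrip θ).mem_nhds hw)]
    with s hs hs'
  have hs0 : (0 : ℝ) < s := hs
  exact (dilogMoment_neg_two_of_pos hθ hε hε' hs' (by simp; linarith)).symm

/-- The zeros `±π, ±3π, …` of `1 + e^{iw}` lie outside the strip. -/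
lemma one_add_exp_ne_zero {θ : ℝ} (hθ : 0 < Real.cos θ) {w : ℂ} (hw : w ∈ dilogStrip θ) :
    1 + exp (I * w) ≠ 0 := by
  intro h
  have h1 : exp (I * w) = exp (Real.pi * I) := by
    rw [exp_pi_mul_I]; linear_combination h
  obtain ⟨k, hk⟩ := exp_eq_exp_iff_exists_int.1 h1
  have h2 : w = ((Real.pi * (1 + 2 * k) : ℝ) : ℂ) := by
    push_cast
    linear_combination (-I) * hk + (w - Real.pi - 2 * k * Real.pi) * I_sq
  have h3 : |(w * exp (θ * I)).re| < Real.pi * Real.cos θ := hw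
  rw [h2, re_ofReal_mul, exp_ofReal_mul_I_re, abs_mul, abs_of_pos hθ, abs_mul,
    abs_of_pos Real.pi_pos, mul_assoc] at h3
  have h4 : |(1 + 2 * k : ℝ)| * Real.cos θ < Real.cos θ := lt_of_mul_lt_mul_left h3 Real.pi_pos.le
  have h5 : |(1 + 2 * k : ℝ)| < 1 := by
    by_contra hcon
    nlinarith
  have h6 : |(1 + 2 * k : ℤ)| < 1 := by exact_mod_cast h5
  rw [abs_lt] at h6
  omega

/-- The reflection formula for the integral, the counterpart of the inversion formula of the
dilogarithm. -/
lemma dilogMoment_add_dilogMoment_neg {θ ε : ℝ} (hθ : θ ∈ Ioo (-(Real.pi / 2)) (Real.pi / 2))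
    (hε : 0 < ε) (hε' : ε < Real.cos θ) {w : ℂ} (hw : w ∈ dilogStrip θ) :
    dilogMoment θ ε (-2) w + dilogMoment θ ε (-2) (-w) =
      -I * w ^ 2 + I * (Real.pi : ℂ) ^ 2 / 3 := by
  have hc : 0 < Real.cos θ := hε.trans hε'
  have h0 := zero_mem_dilogStrip hc
  have hneg : ∀ j : ℤ, ∀ v ∈ dilogStrip θ, HasDerivAt (fun v => dilogMoment θ ε j (-v))
      (-dilogMoment θ ε (j + 1) (-v)) v := fun j v hv => by
    have := (hasDerivAt_dilogMoment hε hε' j (neg_mem_dilogStrip hv)).comp v (hasDerivAt_neg v)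
    simpa [Function.comp_def] using this
  have hopen := isOpen_dilogStrip θ
  have hconn := (convex_dilogStrip θ).isPreconnected
  -- The odd function `J_{-1}(v) - J_{-1}(-v) + 2iv` has derivative zero and vanishes at `0`.
  have e1 : ∀ v ∈ dilogStrip θ, dilogMoment θ ε (-1) v - dilogMoment θ ε (-1) (-v) + 2 * I * v = 0 := by
    have hd : ∀ v ∈ dilogStrip θ, HasDerivAt (fun v => dilogMoment θ ε (-1) v -
        dilogMoment θ ε (-1) (-v) + 2 * I * v) 0 v := fun v hv => by
      refine (((hasDerivAt_dilogMoment hε hε' (-1) hv).sub (hneg (-1) v hv)).add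
        ((hasDerivAt_id v).const_mul (2 * I))).congr_deriv ?_
      have a1 := one_add_exp_mul_dilogMoment hθ hε hε' hv
      have a2 := one_add_exp_mul_dilogMoment hθ hε hε' (neg_mem_dilogStrip hv)
      have a3 : exp (I * v) * exp (I * -v) = 1 := by rw [← exp_add]; simp
      refine (mul_right_inj' (one_add_exp_ne_zero hc hv)).1 ?_
      rw [neg_add_cancel]
      linear_combination a1 + exp (I * v) * a2 - (dilogMoment θ ε 0 (-v) + 2 * I) * a3
    intro v hv
    have := hopen.is_const_of_deriv_eq_zero hconn
      (fun v hv => (hd v hv).differentiableAt.differentiableWithinAt)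
      (fun v hv => (hd v hv).deriv) hv h0
    simpa using this
  have hd : ∀ v ∈ dilogStrip θ, HasDerivAt (fun v => dilogMoment θ ε (-2) v +
      dilogMoment θ ε (-2) (-v) + I * v ^ 2) 0 v := fun v hv => by
    refine (((hasDerivAt_dilogMoment hε hε' (-2) hv).add (hneg (-2) v hv)).add
      ((hasDerivAt_pow 2 v).const_mul I)).congr_deriv ?_
    have := e1 v hv
    rw [show (-2 + 1 : ℤ) = -1 by norm_num]
    push_cast
    linear_combination this
  have h1 := hopen.is_const_of_deriv_eq_zero hconn
    (fun v hv => (hd v hv).differentiableAt.differentiableWithinAt)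
    (fun v hv => (hd v hv).deriv) hw h0
  have h2 := dilogMoment_neg_two_of_nonneg hθ hε hε' h0 (by simp)
  rw [mul_zero, exp_zero, liTwo_neg_one] at h2
  rw [neg_zero, h2] at h1
  linear_combination h1

/-- The dilogarithm, including its analytic continuation across `(-π, π)`, is a contour
integral. -/
theorem dilogMoment_neg_two {θ ε : ℝ} (hθ : θ ∈ Ioo (-(Real.pi / 2)) (Real.pi / 2)) (hε : 0 < ε)
    (hε' : ε < Real.cos θ) {w : ℂ} (hw : w ∈ dilogStrip θ) :
    dilogMoment θ ε (-2) w = -2 * I * liTwoNegExp w := by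
  rw [liTwoNegExp]
  split_ifs with h
  · exact dilogMoment_neg_two_of_nonneg hθ hε hε' hw h
  · have h1 := dilogMoment_neg_two_of_nonneg hθ hε hε' (neg_mem_dilogStrip hw)
      (by rw [neg_im]; linarith)
    have h2 := dilogMoment_add_dilogMoment_neg hθ hε hε' hw
    rw [mul_neg] at h1
    linear_combination h2 - h1

lemma liTwoNegExp_eq {θ ε : ℝ} (hθ : θ ∈ Ioo (-(Real.pi / 2)) (Real.pi / 2)) (hε : 0 < ε)
    (hε' : ε < Real.cos θ) {w : ℂ} (hw : w ∈ dilogStrip θ) :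
    liTwoNegExp w = I / 2 * dilogMoment θ ε (-2) w := by
  rw [dilogMoment_neg_two hθ hε hε' hw]
  linear_combination liTwoNegExp w * I_sq

lemma differentiableOn_liTwoNegExp {θ : ℝ} (hθ : θ ∈ Ioo (-(Real.pi / 2)) (Real.pi / 2)) :
    DifferentiableOn ℂ liTwoNegExp (dilogStrip θ) := by
  obtain ⟨ε, hε, hε'⟩ := exists_between (Real.cos_pos_of_mem_Ioo hθ)
  intro w hw
  refine DifferentiableWithinAt.congr ?_ (fun v hv => liTwoNegExp_eq hθ hε hε' hv)
    (liTwoNegExp_eq hθ hε hε' hw)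
  exact ((hasDerivAt_dilogMoment hε hε' (-2) hw).differentiableAt.const_mul _).differentiableWithinAt

lemma iteratedDeriv_liTwoNegExp {θ ε : ℝ} (hθ : θ ∈ Ioo (-(Real.pi / 2)) (Real.pi / 2))
    (hε : 0 < ε) (hε' : ε < Real.cos θ) {w : ℂ} (hw : w ∈ dilogStrip θ) (m : ℕ) :
    iteratedDeriv m liTwoNegExp w = I / 2 * dilogMoment θ ε (-2 + m) w := by
  have h : liTwoNegExp =ᶠ[𝓝 w] fun v => I / 2 * dilogMoment θ ε (-2) v := by
    filter_upwards [(isOpen_dilogStrip θ).mem_nhds hw] with v hv using liTwoNegExp_eq hθ hε hε' hv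
  rw [h.iteratedDeriv_eq, iteratedDeriv_const_mul_field, iteratedDeriv_dilogMoment hε hε' _ _ hw]

/-! ### The remainder as a contour integral -/

/-- The polynomial `P_γ^{2n}` collects the integrals of the terms of the Laurent expansion. -/
lemma faddeevP_eq {θ ε : ℝ} (hθ : θ ∈ Ioo (-(Real.pi / 2)) (Real.pi / 2)) (hε : 0 < ε)
    (hε' : ε < Real.cos θ) {w : ℂ} (hw : w ∈ dilogStrip θ) (n : ℕ) (γ : ℂ) :
    faddeevP n γ w = 1 / 4 * ∑ m ∈ Finset.range (n + 1),
      cschCoeff m * γ ^ (2 * (m : ℤ) - 1) * dilogMoment θ ε (2 * (m : ℤ) - 2) w := by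
  rw [faddeevP, Finset.mul_sum, Finset.mul_sum]
  refine Finset.sum_congr rfl fun m _ => ?_
  rw [iteratedDeriv_liTwoNegExp hθ hε hε' hw, cschCoeff,
    show (-2 + ((2 * m : ℕ) : ℤ)) = 2 * (m : ℤ) - 2 by push_cast; ring]
  field_simp
  norm_num
  ring

/-- The integrand of `g_γ`, with `1 / sinh (γ z)` replaced by the remainder of its Laurent
expansion. Its value at `z = 0` is `0`, as division by zero gives zero, and this is also its limit
there. -/
noncomputable def remKernel (n : ℕ) (γ w z : ℂ) : ℂ := dilogKernel (-1) w z * cschRem n (γ * z)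

lemma remKernel_eq {n : ℕ} {γ w z : ℂ} (hz : z ≠ 0) :
    remKernel n γ w z = faddeevIntegrand γ w z - ∑ m ∈ Finset.range (n + 1),
      cschCoeff m * γ ^ (2 * (m : ℤ) - 1) * dilogKernel (2 * (m : ℤ) - 2) w z := by
  rw [remKernel, cschRem, mul_sub, Finset.mul_sum]
  congr 1
  · simp only [dilogKernel, faddeevIntegrand, zpow_neg_one, div_eq_mul_inv, mul_inv]
    ring
  · refine Finset.sum_congr rfl fun m _ => ?_
    rw [dilogKernel, dilogKernel, mul_zpow,
      show 2 * (m : ℤ) - 2 = (-1) + (2 * (m : ℤ) - 1) by ring, zpow_add₀ hz]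
    ring

lemma faddeevLogS_sub_faddeevP {θ ε : ℝ} (hθ : θ ∈ Ioo (-(Real.pi / 2)) (Real.pi / 2)) {γ w : ℂ}
    (h : FaddeevAdmissible γ w θ ε) (hw : w ∈ dilogStrip θ) (n : ℕ) :
    faddeevLogS γ w - faddeevP n γ w =
      1 / 4 * ((∫ t, remKernel n γ w (rotatedLine θ ε t)) * exp (θ * I)) := by
  have hk := fun m : ℕ => integrable_dilogKernel h.eps_pos h.eps_lt (2 * (m : ℤ) - 2) hw
  rw [faddeevLogS, faddeevP_eq hθ h.eps_pos h.eps_lt hw, ← h.contourIntegral_eq_faddeevG, ← mul_sub]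
  congr 1
  have e : ∀ t, remKernel n γ w (rotatedLine θ ε t) = faddeevIntegrand γ w (rotatedLine θ ε t) -
      ∑ m ∈ Finset.range (n + 1), cschCoeff m * γ ^ (2 * (m : ℤ) - 1) *
        dilogKernel (2 * (m : ℤ) - 2) w (rotatedLine θ ε t) := fun t =>
    remKernel_eq (rotatedLine_ne_zero h.eps_pos t)
  simp only [e]
  rw [integral_sub h.integrable (integrable_finsetSum _ fun m _ => (hk m).const_mul _),
    integral_finsetSum _ fun m _ => (hk m).const_mul _, sub_mul, Finset.sum_mul,
    faddeevContourIntegral, integral_mul_const]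
  congr 1
  refine Finset.sum_congr rfl fun m _ => ?_
  rw [integral_const_mul, dilogMoment, integral_mul_const]
  ring

lemma eventually_sinh_mul_ne_zero {a : ℂ} (ha : a ≠ 0) : ∀ᶠ z in 𝓝[≠] (0 : ℂ), sinh (a * z) ≠ 0 := by
  have : HasDerivAt (fun z => sinh (a * z)) a 0 := by
    simpa using ((hasDerivAt_id (0 : ℂ)).const_mul a).csinh
  exact this.eventually_ne ha

lemma continuousAt_remKernel_zero {n : ℕ} (hn : 1 ≤ n) {γ : ℂ} (hγ : γ ≠ 0) (w : ℂ) :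
    ContinuousAt (remKernel n γ w) 0 := by
  have hπ : (Real.pi : ℂ) ≠ 0 := ofReal_ne_zero.2 Real.pi_ne_zero
  obtain ⟨C, hC⟩ := exists_norm_cschRem_le hn
  have h0 : remKernel n γ w 0 = 0 := by simp [remKernel, dilogKernel]
  rw [← continuousWithinAt_compl_self, ContinuousWithinAt, h0]
  have h1 : Tendsto (fun z : ℂ => z * (sinh (Real.pi * z))⁻¹) (𝓝[≠] 0) (𝓝 (Real.pi : ℂ)⁻¹) := by
    have hd : HasDerivAt (fun z => sinh (Real.pi * z)) (Real.pi : ℂ) 0 := by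
      simpa using ((hasDerivAt_id (0 : ℂ)).const_mul (Real.pi : ℂ)).csinh
    have := (hasDerivAt_iff_tendsto_slope.1 hd).inv₀ hπ
    refine this.congr fun z => ?_
    simp [slope_def_field, div_eq_mul_inv]
  have h2 : Tendsto (fun z : ℂ => exp (w * z) * (C * γ ^ (2 * n + 1) * z ^ (2 * n - 1))) (𝓝[≠] 0)
      (𝓝 0) := by
    have hc : Continuous fun z : ℂ => exp (w * z) * (C * γ ^ (2 * n + 1) * z ^ (2 * n - 1)) := by
      fun_prop
    have := (hc.tendsto 0).mono_left (nhdsWithin_le_nhds (s := {0}ᶜ))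
    simpa [show 2 * n - 1 ≠ 0 by omega] using this
  have h3 := (h1.mul h2).norm
  rw [mul_zero, norm_zero] at h3
  refine squeeze_zero_norm' ?_ h3
  have hsmall : ∀ᶠ z in 𝓝[≠] (0 : ℂ), ‖γ * z‖ ≤ 1 := by
    have hc : Continuous fun z : ℂ => ‖γ * z‖ := by fun_prop
    have := (hc.tendsto 0).mono_left (nhdsWithin_le_nhds (s := {0}ᶜ))
    rw [mul_zero, norm_zero] at this
    exact this.eventually_le_const one_pos
  filter_upwards [hsmall, eventually_sinh_mul_ne_zero hγ, self_mem_nhdsWithin] with z hz hz' hz0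
  have hz0' : z ≠ 0 := hz0
  have h4 := hC _ hz hz'
  rw [remKernel, dilogKernel, zpow_neg_one]
  simp only [norm_mul, norm_inv, norm_pow, norm_real, Real.norm_eq_abs] at h4 ⊢
  have h5 : ‖cschRem n (γ * z)‖ ≤ |C| * (‖γ‖ * ‖z‖) ^ (2 * n + 1) :=
    h4.trans (by gcongr; exact le_abs_self C)
  have hzp : 0 < ‖z‖ := norm_pos_iff.2 hz0'
  have e1 : ‖z‖ ^ (2 * n + 1) = ‖z‖ ^ (2 * n - 1) * ‖z‖ * ‖z‖ := by
    rw [← pow_succ, ← pow_succ]; congr 1; omega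
  calc _ ≤ ‖exp (w * z)‖ * ‖z‖⁻¹ * ‖sinh (Real.pi * z)‖⁻¹ * (|C| * (‖γ‖ * ‖z‖) ^ (2 * n + 1)) := by
        gcongr
    _ = _ := by
        rw [mul_pow, e1]
        field_simp

lemma differentiableAt_cschRem {n : ℕ} {u : ℂ} (hu : sinh u ≠ 0) :
    DifferentiableAt ℂ (cschRem n) u := by
  have hu0 : u ≠ 0 := by rintro rfl; simp at hu
  unfold cschRem
  refine DifferentiableAt.sub (DifferentiableAt.div (by fun_prop) (by fun_prop) hu) ?_
  refine DifferentiableAt.fun_sum fun m _ => ?_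
  exact (differentiableAt_zpow.2 (Or.inl hu0)).const_mul _

lemma differentiableAt_remKernel {n : ℕ} {γ w z : ℂ} (h0 : z ≠ 0) (h1 : sinh (Real.pi * z) ≠ 0)
    (h2 : sinh (γ * z) ≠ 0) : DifferentiableAt ℂ (remKernel n γ w) z := by
  unfold remKernel
  refine (differentiableAt_dilogKernel h0 h1 _ _).mul ?_
  exact (differentiableAt_cschRem h2).comp (f := fun z => γ * z) z (by fun_prop)

/-- The singularity of the integrand at the origin is removed, so that the line may be moved to
pass through the origin. -/
lemma integral_remKernel_eq {θ ε : ℝ} {γ w : ℂ} (h : FaddeevAdmissible γ w θ ε)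
    (hw : w ∈ dilogStrip θ) {n : ℕ} (hn : 1 ≤ n) :
    ∫ t, remKernel n γ w (rotatedLine θ 0 t) = ∫ t, remKernel n γ w (rotatedLine θ ε t) := by
  have hγ : γ ≠ 0 := by rintro rfl; simpa using h.re_pos
  have hcos := h.eps_pos.trans h.eps_lt
  have hadm : ∀ x ∈ Icc 0 ε, x ≠ 0 → FaddeevAdmissible γ w θ x := fun x hx hx0 =>
    h.mono (lt_of_le_of_ne hx.1 hx0.symm) hx.2
  have hd : ∀ x ∈ Icc 0 ε, ∀ t, rotatedLine θ x t ∉ ({0} : Set ℂ) →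
      DifferentiableAt ℂ (remKernel n γ w) (rotatedLine θ x t) := fun x hx t hz => by
    have hz' : rotatedLine θ x t ≠ 0 := hz
    by_cases hx0 : x = 0
    · subst hx0
      have ht : t ≠ 0 := by rintro rfl; exact hz' (by simp [rotatedLine])
      refine differentiableAt_remKernel hz' (sinh_ne_zero_of_re_ne_zero ?_)
        (sinh_ne_zero_of_re_ne_zero ?_)
      · rw [re_mul_rotatedLine, pi_mul_exp_re, zero_mul, sub_zero]
        exact mul_ne_zero ht (mul_pos Real.pi_pos hcos).ne'
      · rw [re_mul_rotatedLine, zero_mul, sub_zero]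
        exact mul_ne_zero ht h.re_pos.ne'
    · have ha := hadm x hx hx0
      exact differentiableAt_remKernel hz' (sinh_pi_mul_rotatedLine_ne_zero ha.eps_pos ha.eps_lt t)
        (ha.sinh_ne t)
  obtain ⟨C, κ, T₀, hκ, hT₀, hb⟩ :=
    exists_dilogKernel_bound_far (a := 0) (b := ε) hcos hw (2 * (n : ℤ))
  have hg := h.re_pos
  set g := (γ * exp (θ * I)).re with hgdef
  refine integral_rotatedLine_shift (κ := κ) (s := {0})
    (T₀ := max T₀ ((1 + ε * ‖γ‖) / g))
    (C := ‖γ‖ ^ (2 * n + 1) * (1 / (6 * Real.pi ^ (2 * n - 1))) * C)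
    h.eps_pos.le hκ (countable_singleton _) (fun x hx t => ?_) hd fun x hx t ht => ?_
  · by_cases hz : rotatedLine θ x t = 0
    · rw [hz]; exact continuousAt_remKernel_zero hn hγ w
    · exact (hd x hx t hz).continuousAt
  · have t1 : T₀ ≤ |t| := (le_max_left _ _).trans ht
    have t2 : 1 + ε * ‖γ‖ ≤ |t| * g := by
      rw [← div_le_iff₀ hg]; exact (le_max_right _ _).trans ht
    have hre : 1 ≤ |(γ * rotatedLine θ x t).re| := by
      rw [re_mul_rotatedLine, ← hgdef]
      have e1 := abs_sub_abs_le_abs_sub (t * g) (x * (γ * exp (θ * I)).im)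
      rw [abs_mul, abs_of_pos hg, abs_mul, abs_of_nonneg hx.1] at e1
      have e2 := abs_im_le_norm (γ * exp (θ * I))
      rw [norm_mul_exp_mul_I] at e2
      have e3 : x * |(γ * exp (θ * I)).im| ≤ ε * ‖γ‖ :=
        mul_le_mul hx.2 e2 (abs_nonneg _) h.eps_pos.le
      linarith
    have hz : rotatedLine θ x t ≠ 0 := by
      intro h0
      rw [h0] at hre
      norm_num at hre
    have h1 := norm_cschRem_le hn (u := γ * rotatedLine θ x t)
      (abs_pos.1 (one_pos.trans_le hre))
    have h2 : ‖cschRem n (γ * rotatedLine θ x t)‖ ≤ (‖γ‖ * ‖rotatedLine θ x t‖) ^ (2 * n + 1) *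
        (1 / (6 * Real.pi ^ (2 * n - 1))) := by
      refine h1.trans ?_
      have := Real.pi_pos
      rw [norm_mul]
      gcongr
      exact div_le_self (by positivity) hre
    have h3 : ‖dilogKernel (2 * (n : ℤ)) w (rotatedLine θ x t)‖ =
        ‖dilogKernel (-1) w (rotatedLine θ x t)‖ * ‖rotatedLine θ x t‖ ^ (2 * n + 1) := by
      rw [← norm_pow, ← norm_mul, dilogKernel, dilogKernel, ← zpow_natCast,
        show 2 * (n : ℤ) = (-1) + ((2 * n + 1 : ℕ) : ℤ) by push_cast; ring, zpow_add₀ hz]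
      congr 1
      ring
    rw [remKernel, norm_mul]
    calc _ ≤ ‖dilogKernel (-1) w (rotatedLine θ x t)‖ * ((‖γ‖ * ‖rotatedLine θ x t‖) ^ (2 * n + 1) *
          (1 / (6 * Real.pi ^ (2 * n - 1)))) := by gcongr
      _ = ‖γ‖ ^ (2 * n + 1) * (1 / (6 * Real.pi ^ (2 * n - 1))) *
          ‖dilogKernel (2 * (n : ℤ)) w (rotatedLine θ x t)‖ := by rw [h3, mul_pow]; ring
      _ ≤ ‖γ‖ ^ (2 * n + 1) * (1 / (6 * Real.pi ^ (2 * n - 1))) * (C * Real.exp (-κ * |t|)) := by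
          have := Real.pi_pos
          gcongr
          exact hb x hx t t1
      _ = _ := by ring

/-! ### The estimate of the remainder -/

/-- A lower bound for `1 - e^{-as}` by `(1 - e^{-a}) s / (1 + s)`: convexity of the exponential for
`s ≤ 1`, monotonicity for `s ≥ 1`. -/
lemma one_sub_exp_neg_mul_ge {a s : ℝ} (ha : 0 ≤ a) (hs : 0 ≤ s) :
    (1 - Real.exp (-a)) * s ≤ (1 - Real.exp (-(a * s))) * (1 + s) := by
  have h0 : Real.exp (-a) ≤ 1 := Real.exp_le_one_iff.2 (by linarith)
  have h0' : Real.exp (-(a * s)) ≤ 1 := Real.exp_le_one_iff.2 (by linarith [mul_nonneg ha hs])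
  rcases le_total s 1 with h | h
  · have := convexOn_exp.2 (mem_univ 0) (mem_univ (-a)) (sub_nonneg.2 h) hs (by ring)
    simp only [smul_eq_mul, mul_zero, zero_add, Real.exp_zero, mul_one] at this
    rw [show s * -a = -(a * s) by ring] at this
    nlinarith
  · have h1 : Real.exp (-(a * s)) ≤ Real.exp (-a) := by
      rw [Real.exp_le_exp]; nlinarith
    nlinarith

lemma inv_norm_sinh_pi_le {θ t : ℝ} (hθ : 0 < Real.cos θ) (ht : t ≠ 0) :
    ‖(sinh (Real.pi * rotatedLine θ 0 t))⁻¹‖ ≤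
      2 * (1 + |t|) / (|t| * (1 - Real.exp (-(2 * Real.pi * Real.cos θ)))) *
        Real.exp (-(Real.pi * Real.cos θ * |t|)) := by
  have ht' : 0 < |t| := abs_pos.2 ht
  have hp : 0 < Real.pi * Real.cos θ := mul_pos Real.pi_pos hθ
  have h1 := abs_sinh_re_le_norm_sinh (Real.pi * rotatedLine θ 0 t)
  rw [re_mul_rotatedLine, pi_mul_exp_re, zero_mul, sub_zero, abs_mul, abs_of_pos hp,
    Real.sinh_eq] at h1
  have hq : 0 < 1 - Real.exp (-(2 * Real.pi * Real.cos θ)) := by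
    rw [sub_pos, Real.exp_lt_one_iff]; linarith
  have h2 := one_sub_exp_neg_mul_ge (a := 2 * Real.pi * Real.cos θ) (s := |t|) (by linarith) ht'.le
  have h3 : (Real.exp (|t| * (Real.pi * Real.cos θ)) - Real.exp (-(|t| * (Real.pi * Real.cos θ)))) / 2
      = Real.exp (Real.pi * Real.cos θ * |t|) * (1 - Real.exp (-(2 * Real.pi * Real.cos θ * |t|))) / 2 := by
    rw [mul_sub, ← Real.exp_add]; ring_nf
  rw [h3] at h1
  have h4 : Real.exp (Real.pi * Real.cos θ * |t|) *
      (|t| * (1 - Real.exp (-(2 * Real.pi * Real.cos θ))) / (1 + |t|)) / 2 ≤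
      ‖sinh (Real.pi * rotatedLine θ 0 t)‖ := by
    refine le_trans ?_ h1
    gcongr
    rw [div_le_iff₀ (by positivity), mul_comm |t|]
    exact h2
  rw [norm_inv]
  refine (inv_anti₀ (by positivity) h4).trans (le_of_eq ?_)
  generalize 1 - Real.exp (-(2 * Real.pi * Real.cos θ)) = q at *
  rw [Real.exp_neg]
  field_simp

/-- The pointwise bound for the integrand on the line through the origin. -/
lemma norm_remKernel_le {θ δ ψ : ℝ} {γ w : ℂ} (hθ : 0 < Real.cos θ)
    (hψ : 0 < Real.cos ψ) (hγ : (γ * exp (θ * I)).re = ‖γ‖ * Real.cos ψ) (hγ0 : γ ≠ 0)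
    (hw : |(w * exp (θ * I)).re| ≤ Real.pi * Real.cos θ - δ) {n : ℕ} (hn : 1 ≤ n) (t : ℝ) :
    ‖remKernel n γ w (rotatedLine θ 0 t)‖ ≤
      ‖γ‖ ^ (2 * n) / (3 * Real.cos ψ * Real.pi ^ (2 * n - 1) *
        (1 - Real.exp (-(2 * Real.pi * Real.cos θ)))) *
        (|t| ^ (2 * n - 1) * Real.exp (-(δ * |t|)) + |t| ^ (2 * n - 2) * Real.exp (-(δ * |t|))) := by
  have hπ := Real.pi_pos
  have hγn : 0 < ‖γ‖ := norm_pos_iff.2 hγ0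
  have hq : 0 < 1 - Real.exp (-(2 * Real.pi * Real.cos θ)) := by
    rw [sub_pos, Real.exp_lt_one_iff]; linarith [mul_pos hπ hθ]
  by_cases ht : t = 0
  · subst ht
    have : remKernel n γ w (rotatedLine θ 0 0) = 0 := by
      simp [remKernel, dilogKernel, rotatedLine]
    rw [this, norm_zero]
    positivity
  have ht' : 0 < |t| := abs_pos.2 ht
  have hnz : ‖rotatedLine θ 0 t‖ = |t| := by
    rw [norm_rotatedLine]; simp
  have h1 := norm_exp_mul_rotatedLine_le w θ 0 t
  rw [abs_zero, zero_mul, Real.exp_zero, mul_one] at h1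
  have h1' : ‖exp (w * rotatedLine θ 0 t)‖ ≤ Real.exp ((Real.pi * Real.cos θ - δ) * |t|) :=
    h1.trans (by gcongr)
  have h2 := inv_norm_sinh_pi_le hθ ht
  have hre : (γ * rotatedLine θ 0 t).re = t * (‖γ‖ * Real.cos ψ) := by
    rw [re_mul_rotatedLine, hγ, zero_mul, sub_zero]
  have h3 := norm_cschRem_le hn (u := γ * rotatedLine θ 0 t) (by rw [hre]; positivity)
  rw [hre, norm_mul, hnz, abs_mul, abs_of_pos (mul_pos hγn hψ)] at h3
  rw [remKernel, dilogKernel, zpow_neg_one, norm_mul, norm_mul, norm_mul, norm_inv (rotatedLine θ 0 t),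
    hnz]
  calc _ ≤ Real.exp ((Real.pi * Real.cos θ - δ) * |t|) * |t|⁻¹ *
        (2 * (1 + |t|) / (|t| * (1 - Real.exp (-(2 * Real.pi * Real.cos θ)))) *
          Real.exp (-(Real.pi * Real.cos θ * |t|))) *
        ((‖γ‖ * |t|) ^ (2 * n + 1) / (|t| * (‖γ‖ * Real.cos ψ)) *
          (1 / (6 * Real.pi ^ (2 * n - 1)))) := by gcongr
    _ = _ := by
        have e1 : Real.exp ((Real.pi * Real.cos θ - δ) * |t|) *
            Real.exp (-(Real.pi * Real.cos θ * |t|)) = Real.exp (-(δ * |t|)) := by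
          rw [← Real.exp_add]; ring_nf
        have e2 : |t| ^ (2 * n + 1) = |t| ^ (2 * n - 2) * |t| ^ 3 := by
          rw [← pow_add]; congr 1; omega
        have e3 : |t| ^ (2 * n - 1) = |t| ^ (2 * n - 2) * |t| := by
          rw [← pow_succ]; congr 1; omega
        rw [mul_pow, e2, e3, ← e1]
        generalize Real.exp ((Real.pi * Real.cos θ - δ) * |t|) = A
        generalize Real.exp (-(Real.pi * Real.cos θ * |t|)) = B
        generalize 1 - Real.exp (-(2 * Real.pi * Real.cos θ)) = q at *
        field_simp
        ring

lemma integrable_abs_pow_mul_exp {δ : ℝ} (hδ : 0 < δ) (k : ℕ) :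
    Integrable fun t : ℝ => |t| ^ k * Real.exp (-(δ * |t|)) := by
  have := (integrable_of_exp_bound (h := fun t : ℝ => ((|t| ^ k * Real.exp (-(δ * |t|)) : ℝ) : ℂ))
    (C := k.factorial * (2 / δ) ^ k) (κ := δ / 2) (T₀ := 0) (by positivity) (by fun_prop)
    (fun t _ => ?_)).re
  · simpa only [RCLike.re_eq_complex_re, ofReal_re] using this
  · rw [norm_real, Real.norm_of_nonneg (by positivity)]
    have h1 := Real.pow_div_factorial_le_exp (δ / 2 * |t|) (by positivity) k
    rw [div_le_iff₀ (by positivity), mul_pow] at h1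
    have h2 : |t| ^ k ≤ k.factorial * (2 / δ) ^ k * Real.exp (δ / 2 * |t|) := by
      have e : |t| ^ k = (2 / δ) ^ k * ((δ / 2) ^ k * |t| ^ k) := by
        rw [← mul_assoc, ← mul_pow]; field_simp; simp
      rw [e]
      calc _ ≤ (2 / δ) ^ k * (Real.exp (δ / 2 * |t|) * k.factorial) := by gcongr
        _ = _ := by ring
    calc _ ≤ k.factorial * (2 / δ) ^ k * Real.exp (δ / 2 * |t|) * Real.exp (-(δ * |t|)) := by gcongr
      _ = _ := by rw [mul_assoc, ← Real.exp_add]; ring_nf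

lemma integral_abs_pow_mul_exp {δ : ℝ} (hδ : 0 < δ) (k : ℕ) :
    ∫ t : ℝ, |t| ^ k * Real.exp (-(δ * |t|)) = 2 * (k.factorial / δ ^ (k + 1)) := by
  rw [integral_comp_abs (f := fun t : ℝ => t ^ k * Real.exp (-(δ * t)))]
  have := Real.integral_rpow_mul_exp_neg_mul_Ioi (a := (k : ℝ) + 1) (by positivity) hδ
  rw [Real.Gamma_nat_eq_factorial] at this
  simp only [add_sub_cancel_right, Real.rpow_natCast] at this
  rw [this, show ((k : ℝ) + 1) = ((k + 1 : ℕ) : ℝ) by push_cast; ring, Real.rpow_natCast, one_div,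
    inv_pow, inv_mul_eq_div]

lemma norm_integral_remKernel_le {θ δ ψ : ℝ} {γ w : ℂ} (hθ : 0 < Real.cos θ) (hδ : 0 < δ)
    (hψ : 0 < Real.cos ψ) (hγ : (γ * exp (θ * I)).re = ‖γ‖ * Real.cos ψ) (hγ0 : γ ≠ 0)
    (hw : |(w * exp (θ * I)).re| ≤ Real.pi * Real.cos θ - δ) {n : ℕ} (hn : 1 ≤ n) :
    ‖∫ t, remKernel n γ w (rotatedLine θ 0 t)‖ ≤
      ‖γ‖ ^ (2 * n) / (3 * Real.cos ψ * Real.pi ^ (2 * n - 1) *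
        (1 - Real.exp (-(2 * Real.pi * Real.cos θ)))) *
        (2 * ((2 * n - 1).factorial / δ ^ (2 * n)) +
          2 * ((2 * n - 2).factorial / δ ^ (2 * n - 1))) := by
  have i1 := integrable_abs_pow_mul_exp hδ (2 * n - 1)
  have i2 := integrable_abs_pow_mul_exp hδ (2 * n - 2)
  refine (norm_integral_le_of_norm_le ((i1.add i2).const_mul _) (Eventually.of_forall
    fun t => norm_remKernel_le hθ hψ hγ hγ0 hw hn t)).trans (le_of_eq ?_)
  have e1 := integral_abs_pow_mul_exp hδ (2 * n - 1)
  have e2 := integral_abs_pow_mul_exp hδ (2 * n - 2)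
  rw [show 2 * n - 1 + 1 = 2 * n by omega] at e1
  rw [show 2 * n - 2 + 1 = 2 * n - 1 by omega] at e2
  rw [integral_const_mul]
  congr 1
  rw [← e1, ← e2]
  exact integral_add i1 i2

/-! ### The constants -/

lemma faddeevCF_pos : 0 < faddeevCF := by
  have : Real.exp (-2) < 1 := Real.exp_lt_one_iff.2 (by norm_num)
  have h : 0 < 1 - Real.exp (-2) := by linarith
  have := Real.pi_pos
  unfold faddeevCF
  positivity

lemma faddeevCF_le : faddeevCF ≤ 0.93 := by
  have h1 : √2 ≤ 1.4143 := Real.sqrt_le_iff.2 ⟨by norm_num, by norm_num⟩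
  have h2 : 1.77 ≤ √Real.pi := Real.le_sqrt_of_sq_le (by nlinarith [Real.pi_gt_d2])
  have h3 : Real.exp (-2) ≤ 0.14 := by
    rw [Real.exp_neg, show (2 : ℝ) = 1 + 1 by norm_num, Real.exp_add]
    rw [inv_le_comm₀ (by positivity) (by norm_num)]
    nlinarith [Real.exp_one_gt_d9]
  unfold faddeevCF
  rw [div_le_iff₀ (by nlinarith)]
  nlinarith

lemma bddBelow_faddeevC' (N : ℕ) : BddBelow (range fun r : Ioo (0 : ℝ) Real.pi =>
    1 / (r : ℝ) ^ N * (faddeevCF / (r : ℝ) + 1 / Real.sin (r : ℝ))) := by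
  refine ⟨0, ?_⟩
  rintro _ ⟨⟨r, hr⟩, rfl⟩
  have h1 := hr.1
  have h2 := Real.sin_pos_of_pos_of_lt_pi hr.1 hr.2
  have h3 := faddeevCF_pos
  simp only
  positivity

/-- On `(0, π)` one has `r⁻ᴺ ≥ π⁻ᴺ` and `1 / sin r ≥ 1`. -/
lemma one_div_pi_pow_le_faddeevC' (N : ℕ) : 1 / Real.pi ^ N ≤ faddeevC' N := by
  have : Nonempty (Ioo (0 : ℝ) Real.pi) := ⟨⟨1, one_pos, by linarith [Real.pi_gt_three]⟩⟩
  refine le_ciInf fun ⟨r, hr⟩ => ?_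
  have h1 := hr.1
  have h2 := Real.sin_pos_of_pos_of_lt_pi hr.1 hr.2
  have h3 := faddeevCF_pos
  have h4 : 1 ≤ 1 / Real.sin r := by
    rw [le_div_iff₀ h2, one_mul]; exact Real.sin_le_one r
  have h5 : 1 ≤ faddeevCF / r + 1 / Real.sin r := by
    have : 0 < faddeevCF / r := by positivity
    linarith
  have h6 : 1 / Real.pi ^ N ≤ 1 / r ^ N := by
    gcongr
    exact hr.2.le
  exact h6.trans (le_mul_of_one_le_right (by positivity) h5)

/-- The value of the function to be minimised at `r = 3π / 4`. -/
lemma faddeevC'_le (N : ℕ) : faddeevC' N ≤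
    (√2 + 4 * faddeevCF / (3 * Real.pi)) * (2 / 3) ^ N * (2 / Real.pi) ^ N := by
  have hπ := Real.pi_pos
  refine (ciInf_le (bddBelow_faddeevC' N) ⟨3 * Real.pi / 4, by positivity, by linarith⟩).trans
    (le_of_eq ?_)
  have hsin : Real.sin (3 * Real.pi / 4) = √2 / 2 := by
    rw [show 3 * Real.pi / 4 = Real.pi - Real.pi / 4 by ring, Real.sin_pi_sub, Real.sin_pi_div_four]
  have h2 : 1 / (√2 / 2) = √2 := by
    have : √2 * √2 = 2 := Real.mul_self_sqrt (by norm_num)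
    field_simp
    linarith
  simp only [hsin, h2]
  rw [mul_assoc, ← mul_pow, one_div, ← inv_pow]
  have e1 : (3 * Real.pi / 4)⁻¹ = 2 / 3 * (2 / Real.pi) := by field_simp; norm_num
  have e2 : faddeevCF / (3 * Real.pi / 4) = 4 * faddeevCF / (3 * Real.pi) := by field_simp
  rw [e1, e2]
  ring

lemma sqrt_four_mul_sub_three_pos {n : ℕ} (hn : 1 ≤ n) : 0 < √(4 * (n : ℝ) - 3) := by
  have : (1 : ℝ) ≤ n := by exact_mod_cast hn
  exact Real.sqrt_pos.2 (by linarith)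

lemma one_sub_half_pow_pos {n : ℕ} (hn : 1 ≤ n) : 0 < (1 - 1 / (2 * (n : ℝ))) ^ (2 * n - 1) := by
  have h1 : (1 : ℝ) ≤ n := by exact_mod_cast hn
  have : 1 / (2 * (n : ℝ)) ≤ 1 / 2 := by gcongr; linarith
  exact pow_pos (by linarith) _

/-- The reciprocal of the power is `(1 + 1 / (2n - 1)) ^ (2n - 1) ≤ e`. -/
lemma one_third_le_one_sub_half_pow {n : ℕ} (hn : 1 ≤ n) :
    1 / 3 ≤ (1 - 1 / (2 * (n : ℝ))) ^ (2 * n - 1) := by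
  have h1 : (1 : ℝ) ≤ n := by exact_mod_cast hn
  have hX := one_sub_half_pow_pos hn
  set a : ℝ := 1 / (2 * (n : ℝ) - 1) with ha
  have ha0 : (2 * (n : ℝ) - 1) ≠ 0 := by linarith
  have h2 : (1 - 1 / (2 * (n : ℝ))) * (1 + a) = 1 := by
    rw [ha]; field_simp; ring
  have h3 : (1 + a) ^ (2 * n - 1) ≤ 3 := by
    have e1 : 1 + a ≤ Real.exp a := by linarith [Real.add_one_le_exp a]
    have e0 : 0 ≤ a := by rw [ha]; exact div_nonneg one_pos.le (by linarith)
    calc (1 + a) ^ (2 * n - 1) ≤ Real.exp a ^ (2 * n - 1) := by gcongr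
      _ = Real.exp 1 := by
        rw [← Real.exp_nat_mul, Nat.cast_sub (by omega), ha]
        push_cast
        field_simp
      _ ≤ 3 := by linarith [Real.exp_one_lt_d9]
  have h4 : (1 - 1 / (2 * (n : ℝ))) ^ (2 * n - 1) * (1 + a) ^ (2 * n - 1) = 1 := by
    rw [← mul_pow, h2, one_pow]
  nlinarith

lemma faddeevConst_le {n : ℕ} (hn : 1 ≤ n) {θ : ℝ} {γ : ℂ}
    (hQ : 0 < (1 - Real.exp (-(2 * Real.pi * Real.cos θ))) * Real.cos (θ + arg γ)) :
    faddeevConst n θ γ ≤ 4 * √2 / (Real.pi * √(4 * (n : ℝ) - 3)) *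
      ((√2 + 4 * faddeevCF / (3 * Real.pi)) / (1 - 1 / (2 * (n : ℝ))) ^ (2 * n - 1)) *
      (2 / 3) ^ (2 * n) *
      (1 / ((1 - Real.exp (-(2 * Real.pi * Real.cos θ))) * Real.cos (θ + arg γ))) *
      (2 / Real.pi) ^ (2 * n) := by
  have hs := sqrt_four_mul_sub_three_pos hn
  have hX := one_sub_half_pow_pos hn
  have hπ := Real.pi_pos
  rw [faddeevConst]
  generalize (1 - Real.exp (-(2 * Real.pi * Real.cos θ))) * Real.cos (θ + arg γ) = Q at *
  generalize (1 - 1 / (2 * (n : ℝ))) ^ (2 * n - 1) = X at *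
  calc _ ≤ 4 * √2 / (Real.pi * √(4 * (n : ℝ) - 3)) * (1 / X) *
        ((√2 + 4 * faddeevCF / (3 * Real.pi)) * (2 / 3) ^ (2 * n) * (2 / Real.pi) ^ (2 * n) / Q) := by
        gcongr
        exact faddeevC'_le _
    _ = _ := by ring

lemma const_le_three {n : ℕ} (hn : 1 ≤ n) :
    4 * √2 / (Real.pi * √(4 * (n : ℝ) - 3)) *
      ((√2 + 4 * faddeevCF / (3 * Real.pi)) / (1 - 1 / (2 * (n : ℝ))) ^ (2 * n - 1)) *
      (2 / 3) ^ (2 * n) ≤ 3 := by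
  have hπ := Real.pi_gt_d2
  have hcf := faddeevCF_pos
  have h2 : √2 ≤ 1.4143 := Real.sqrt_le_iff.2 ⟨by norm_num, by norm_num⟩
  have hK : √2 + 4 * faddeevCF / (3 * Real.pi) ≤ 1.82 := by
    have : 4 * faddeevCF / (3 * Real.pi) ≤ 0.4 := by
      rw [div_le_iff₀ (by linarith)]
      nlinarith [faddeevCF_le]
    linarith
  have hn1 : (1 : ℝ) ≤ n := by exact_mod_cast hn
  have hs : 1 ≤ √(4 * (n : ℝ) - 3) := Real.one_le_sqrt.2 (by linarith)
  have hA : 4 * √2 / (Real.pi * √(4 * (n : ℝ) - 3)) ≤ 1.81 := by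
    rw [div_le_iff₀ (by positivity)]
    nlinarith
  have hX := one_sub_half_pow_pos hn
  rcases eq_or_lt_of_le hn with rfl | hn2
  · norm_num at hA hX ⊢
    calc _ ≤ 181 / 100 * (1.82 / (1 / 2)) * (4 / 9 : ℝ) := by gcongr
      _ ≤ 3 := by norm_num
  · have hX3 := one_third_le_one_sub_half_pow hn
    have hp : (2 / 3 : ℝ) ^ (2 * n) ≤ (2 / 3) ^ 4 :=
      pow_le_pow_of_le_one (by norm_num) (by norm_num) (by omega)
    calc _ ≤ 1.81 * (1.82 / (1 / 3)) * (2 / 3 : ℝ) ^ 4 := by gcongr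
      _ ≤ 3 := by norm_num

/-- The constant of the theorem dominates the one obtained by integrating the pointwise bound. -/
lemma remainder_bound_le_faddeevConst {n : ℕ} (hn : 1 ≤ n) {θ δ : ℝ} {γ : ℂ}
    (hq : 0 < 1 - Real.exp (-(2 * Real.pi * Real.cos θ))) (hψ : 0 < Real.cos (θ + arg γ))
    (hδ : 0 < δ) (hδπ : δ ≤ Real.pi) :
    1 / 4 * (‖γ‖ ^ (2 * n) / (3 * Real.cos (θ + arg γ) * Real.pi ^ (2 * n - 1) *
        (1 - Real.exp (-(2 * Real.pi * Real.cos θ)))) *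
        (2 * ((2 * n - 1).factorial / δ ^ (2 * n)) +
          2 * ((2 * n - 2).factorial / δ ^ (2 * n - 1)))) ≤
      faddeevConst n θ γ * ‖γ‖ ^ (2 * n) * (δ ^ (2 * n))⁻¹ * ((2 * n).factorial : ℝ) := by
  have hπ := Real.pi_pos
  have hn1 : (1 : ℝ) ≤ n := by exact_mod_cast hn
  have hs := sqrt_four_mul_sub_three_pos hn
  have hX := one_sub_half_pow_pos hn
  have hX1 : (1 - 1 / (2 * (n : ℝ))) ^ (2 * n - 1) ≤ 1 := by
    have h1 : 0 < 1 / (2 * (n : ℝ)) := by positivity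
    have h2 : 1 / (2 * (n : ℝ)) ≤ 1 / 2 := by gcongr; linarith
    exact pow_le_one₀ (by linarith) (by linarith)
  obtain ⟨k, rfl⟩ : ∃ k, n = k + 1 := ⟨n - 1, by omega⟩
  have f1 : (((2 * (k + 1) - 1).factorial : ℕ) : ℝ) = (2 * k + 1) * ((2 * k).factorial : ℝ) := by
    rw [show 2 * (k + 1) - 1 = 2 * k + 1 by omega, Nat.factorial_succ]; push_cast; ring
  have f2 : (((2 * (k + 1)).factorial : ℕ) : ℝ) =
      (2 * k + 2) * ((2 * k + 1) * ((2 * k).factorial : ℝ)) := by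
    rw [show 2 * (k + 1) = 2 * k + 1 + 1 by omega, Nat.factorial_succ, Nat.factorial_succ]
    push_cast; ring
  have hδ1 : ((2 * k).factorial : ℝ) / δ ^ (2 * (k + 1) - 1) ≤
      Real.pi * (2 * k).factorial / δ ^ (2 * (k + 1)) := by
    rw [show δ ^ (2 * (k + 1)) = δ ^ (2 * (k + 1) - 1) * δ by rw [← pow_succ]; congr 1,
      div_le_div_iff₀ (by positivity) (by positivity)]
    have : (0 : ℝ) ≤ (2 * k).factorial * δ ^ (2 * (k + 1) - 1) := by positivity
    nlinarith
  have hsq : √(4 * ((k + 1 : ℕ) : ℝ) - 3) ≤ √2 * (k + 1) := by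
    rw [← Real.sqrt_sq (by positivity : (0 : ℝ) ≤ k + 1), ← Real.sqrt_mul (by norm_num)]
    refine Real.sqrt_le_sqrt ?_
    push_cast
    nlinarith [sq_nonneg (k : ℝ)]
  have hnum : (2 * k + 1 + Real.pi) * Real.pi ^ 2 / 6 ≤ 8 * (2 * (k : ℝ) + 1) := by
    have h1 := Real.pi_lt_d2
    have h2 : Real.pi ^ 2 ≤ 9.9225 := by nlinarith
    have h3 : (2 * k + 1 + Real.pi) * Real.pi ^ 2 ≤ (2 * k + 1 + 3.15) * 9.9225 := by gcongr
    have h4 : (0 : ℝ) ≤ k := k.cast_nonneg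
    linarith
  have hC := one_div_pi_pow_le_faddeevC' (2 * (k + 1))
  rw [faddeevConst, f1, f2, show 2 * (k + 1) - 2 = 2 * k by omega]
  generalize hQ : 1 - Real.exp (-(2 * Real.pi * Real.cos θ)) = q at *
  generalize hc : Real.cos (θ + arg γ) = c at *
  generalize hXX : (1 - 1 / (2 * ((k + 1 : ℕ) : ℝ))) ^ (2 * (k + 1) - 1) = X at *
  have hF : (0 : ℝ) ≤ (2 * k).factorial := by positivity
  generalize ((2 * k).factorial : ℝ) = F at *
  have hpp : Real.pi ^ (2 * (k + 1)) = Real.pi ^ (2 * (k + 1) - 1) * Real.pi := by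
    rw [← pow_succ]; congr 1
  rw [hpp] at hC
  have hp : 0 < Real.pi ^ (2 * (k + 1) - 1) := by positivity
  generalize Real.pi ^ (2 * (k + 1) - 1) = p at *
  have hE : 0 < δ ^ (2 * (k + 1)) := by positivity
  calc _ ≤ 1 / 4 * (‖γ‖ ^ (2 * (k + 1)) / (3 * c * p * q) *
        (2 * ((2 * k + 1) * F / δ ^ (2 * (k + 1))) +
          2 * (Real.pi * F / δ ^ (2 * (k + 1))))) := by gcongr
    _ = ‖γ‖ ^ (2 * (k + 1)) * F / (c * p * q * δ ^ (2 * (k + 1))) / Real.pi ^ 2 *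
        ((2 * k + 1 + Real.pi) * Real.pi ^ 2 / 6) := by
        field_simp
        ring
    _ ≤ ‖γ‖ ^ (2 * (k + 1)) * F / (c * p * q * δ ^ (2 * (k + 1))) / Real.pi ^ 2 *
        (8 * (2 * (k : ℝ) + 1)) := by gcongr
    _ = 4 * √2 / (Real.pi * (√2 * (k + 1))) * (1 / 1) * (1 / (p * Real.pi) / (q * c)) *
        ‖γ‖ ^ (2 * (k + 1)) * (δ ^ (2 * (k + 1)))⁻¹ *
        ((2 * k + 2) * ((2 * k + 1) * F)) := by
        field_simp
        ring
    _ ≤ _ := by gcongr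

/-! ### Asymptotics of the quantum dilogarithm -/

lemma re_mul_exp_eq_norm_mul_cos (γ : ℂ) (θ : ℝ) :
    (γ * exp (θ * I)).re = ‖γ‖ * Real.cos (θ + arg γ) := by
  conv_lhs => rw [← norm_mul_exp_arg_mul_I γ]
  rw [mul_assoc, ← exp_add, re_ofReal_mul, ← add_mul, ← ofReal_add, exp_ofReal_mul_I_re, add_comm]

lemma abs_re_mul_exp_lt_of_mem_faddeevW {θ δ : ℝ} {w : ℂ} (hw : w ∈ faddeevW θ δ) :
    |(w * exp (θ * I)).re| < Real.pi * Real.cos θ - δ := by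
  rw [mul_re, exp_ofReal_mul_I_re, exp_ofReal_mul_I_im, abs_lt]
  exact ⟨by linarith [hw.1], hw.2⟩

lemma faddeevW_subset_dilogStrip {θ δ : ℝ} (hδ : 0 < δ) : faddeevW θ δ ⊆ dilogStrip θ :=
  fun _ hw => (abs_re_mul_exp_lt_of_mem_faddeevW hw).trans (by linarith)

lemma exists_faddeevAdmissible {θ δ : ℝ} (hθ : θ ∈ Ioo (-(Real.pi / 2)) (Real.pi / 2)) (hδ : 0 < δ)
    {w γ : ℂ} (hw : w ∈ faddeevW θ δ) (hγ : γ ∈ faddeevU θ) :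
    ∃ ε : ℝ, FaddeevAdmissible γ w θ ε := by
  have hn : 0 < ‖γ‖ := norm_pos_iff.2 hγ.1
  have hg : 0 < (γ * exp (θ * I)).re := by
    rw [re_mul_exp_eq_norm_mul_cos]; exact mul_pos hn hγ.2
  have hb : 0 < Real.pi * (γ * exp (θ * I)).re / ‖γ‖ ^ 2 :=
    div_pos (mul_pos Real.pi_pos hg) (by positivity)
  obtain ⟨ε, hε, hε'⟩ := exists_between (lt_min (Real.cos_pos_of_mem_Ioo hθ) hb)
  refine ⟨ε, hθ.1, hθ.2, hg, ?_, hε, hε'.trans_le (min_le_left _ _), ?_⟩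
  · rw [add_mul, add_re, pi_mul_exp_re]
    linarith [abs_re_mul_exp_lt_of_mem_faddeevW hw]
  · rw [← lt_div_iff₀ (by positivity)]
    exact hε'.trans_le (min_le_right _ _)

lemma norm_faddeevLogS_sub_faddeevP_le {θ δ : ℝ} (hθ : θ ∈ Ioo (-(Real.pi / 2)) (Real.pi / 2))
    (hδ : 0 < δ) (hδ' : δ < Real.pi * Real.cos θ) {w γ : ℂ} (hw : w ∈ faddeevW θ δ)
    (hγ : γ ∈ faddeevU θ) {n : ℕ} (hn : 1 ≤ n) :
    ‖faddeevLogS γ w - faddeevP n γ w‖ ≤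
      faddeevConst n θ γ * ‖γ‖ ^ (2 * n) * (δ ^ (2 * n))⁻¹ * ((2 * n).factorial : ℝ) := by
  have hcos := Real.cos_pos_of_mem_Ioo hθ
  have hπ := Real.pi_pos
  obtain ⟨ε, hadm⟩ := exists_faddeevAdmissible hθ hδ hw hγ
  have hstrip := faddeevW_subset_dilogStrip hδ hw
  have hq : 0 < 1 - Real.exp (-(2 * Real.pi * Real.cos θ)) := by
    rw [sub_pos, Real.exp_lt_one_iff]; linarith [mul_pos hπ hcos]
  rw [faddeevLogS_sub_faddeevP hθ hadm hstrip, ← integral_remKernel_eq hadm hstrip hn, norm_mul,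
    norm_mul, norm_exp_ofReal_mul_I, mul_one]
  refine le_trans ?_ (remainder_bound_le_faddeevConst hn hq hγ.2 hδ
    (hδ'.le.trans (mul_le_of_le_one_right hπ.le (Real.cos_le_one θ))))
  have h4 : ‖(1 / 4 : ℂ)‖ = 1 / 4 := by norm_num
  rw [h4]
  gcongr
  exact norm_integral_remKernel_le hcos hδ hγ.2 (re_mul_exp_eq_norm_mul_cos γ θ) hγ.1
    (abs_re_mul_exp_lt_of_mem_faddeevW hw).le hn

end

theorem mainTheorem5 (θ : ℝ) (hθ : θ ∈ Set.Ioo (-(Real.pi / 2)) (Real.pi / 2))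
    (δ : ℝ) (hδ : 0 < δ) (hδ' : δ < Real.pi * Real.cos θ) :
    DifferentiableOn ℂ liTwoNegExp (faddeevW θ δ) ∧
    ∀ w ∈ faddeevW θ δ, ∀ γ ∈ faddeevU θ,
      (∃ ε : ℝ, FaddeevAdmissible γ w θ ε) ∧
      (∀ φ ε : ℝ, FaddeevAdmissible γ w φ ε →
        MeasureTheory.Integrable (fun t : ℝ => faddeevIntegrand γ w (rotatedLine φ ε t)) ∧
        faddeevContourIntegral φ ε γ w = faddeevG γ w) ∧
      faddeevS γ w = Complex.exp (faddeevLogS γ w) ∧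
      ∀ n : ℕ, 1 ≤ n →
        ‖faddeevLogS γ w - faddeevP n γ w‖ ≤
          faddeevConst n θ γ * ‖γ‖ ^ (2 * n) * (δ ^ (2 * n))⁻¹ * ((2 * n).factorial : ℝ) ∧
        faddeevConst n θ γ ≤
          4 * √2 / (Real.pi * √(4 * (n : ℝ) - 3)) *
            ((√2 + 4 * faddeevCF / (3 * Real.pi)) / (1 - 1 / (2 * (n : ℝ))) ^ (2 * n - 1)) *
            (2 / 3) ^ (2 * n) *
            (1 / ((1 - Real.exp (-(2 * Real.pi * Real.cos θ))) *
              Real.cos (θ + Complex.arg γ))) *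
            (2 / Real.pi) ^ (2 * n) ∧
        4 * √2 / (Real.pi * √(4 * (n : ℝ) - 3)) *
            ((√2 + 4 * faddeevCF / (3 * Real.pi)) / (1 - 1 / (2 * (n : ℝ))) ^ (2 * n - 1)) *
            (2 / 3) ^ (2 * n) *
            (1 / ((1 - Real.exp (-(2 * Real.pi * Real.cos θ))) *
              Real.cos (θ + Complex.arg γ))) *
            (2 / Real.pi) ^ (2 * n) ≤
          3 / ((1 - Real.exp (-(2 * Real.pi * Real.cos θ))) *
              Real.cos (θ + Complex.arg γ)) * (2 / Real.pi) ^ (2 * n) := by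
  refine ⟨(differentiableOn_liTwoNegExp hθ).mono (faddeevW_subset_dilogStrip hδ),
    fun w hw γ hγ => ⟨exists_faddeevAdmissible hθ hδ hw hγ,
      fun φ ε h => ⟨h.integrable, h.contourIntegral_eq_faddeevG⟩, rfl, fun n hn => ?_⟩⟩
  have hq : 0 < 1 - Real.exp (-(2 * Real.pi * Real.cos θ)) := by
    rw [sub_pos, Real.exp_lt_one_iff]
    linarith [mul_pos Real.pi_pos (Real.cos_pos_of_mem_Ioo hθ)]
  have hQ : 0 < (1 - Real.exp (-(2 * Real.pi * Real.cos θ))) * Real.cos (θ + Complex.arg γ) :=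
    mul_pos hq hγ.2
  refine ⟨norm_faddeevLogS_sub_faddeevP_le hθ hδ hδ' hw hγ hn, faddeevConst_le hn hQ, ?_⟩
  have hpi : 0 < (2 / Real.pi) ^ (2 * n) := by have := Real.pi_pos; positivity
  rw [div_eq_mul_one_div 3]
  exact mul_le_mul_of_nonneg_right
    (mul_le_mul_of_nonneg_right (const_le_three hn) (one_div_pos.2 hQ).le) hpi.le
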